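/- All topological groups are second countable and Hausdorff; TDLC means totally disconnected and locally compact. A compactly generated TDLC group is called hyperbolic if some (equivalently, any) Cayley–Abels graph of it (a connected locally finite graph on which the group acts by automorphisms, vertex transitively and with compact open vertex stabilizers) is Gromov hyperbolic, and non-elementary hyperbolic if moreover the Gromov boundary of this graph has at least three points. Let $G$ be a compactly generated TDLC group, $K\subseteq G$ a compact generating set, $U\le G$ a compact open subgroup, and $A\subseteq G$ a finite symmetric set containing $1$ with $K\subseteq AU$, $UAU=AU$ and $G=\langle A\rangle U$. The Cayley–Abels graph $\Gamma_G=\Gamma_G(K,U,A)$ has vertex set $V(\Gamma_G)=\{gU: g\in G\}$ and edges $\{gU,gaU\}$ with $g\in G$, $a\in A$; its path metric on vertices is $$d_A(gU,g'U)=\min\{n\ge 0:\ g^{-1}g'U=a_1a_2\cdots a_nU\ \text{for some } a_1,\dots,a_n\in A\}.$$ If $p:G\to Q$ is a continuous open surjective homomorphism of TDLC groups, then $p(K),p(U),p(A)$ have the same properties in $Q$; let $\Gamma_Q=\Gamma_Q(p(K),p(U),p(A))$, with metric $d_{p(A)}$. A quasiisometric section of $p$ is a subset $\Sigma\subseteq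 V(\Gamma_G)$ such that $\{p(g)p(U): gU\in\Sigma\}=V(\Gamma_Q)$ and, for some constants $k\ge 1$ and $\epsilon\ge 0$ and all $gU,g'U\in\Sigma$, $$\tfrac1k\, d_{p(A)}(p(g)p(U),p(g')p(U))-\epsilon\ \le\ d_A(gU,g'U)\ \le\ k\, d_{p(A)}(p(g)p(U),p(g')p(U))+\epsilon .$$ **Proposition.** Let $1\to H\to G\xrightarrow{\,p\,}Q\to 1$ be a short exact sequence of compactly generated TDLC groups in which both maps $H\to G$ and $p$ are continuous open homomorphisms, and suppose that $H$ is non-elementary hyperbolic. Then for every choice of $K,U,A$ as above, $p$ has a quasiisometric section $\Sigma\subseteq V(\Gamma_G)$, and there are constants $k\ge 1$ and $\epsilon_0\ge 0$ such that for all $gU,g'U\in\Sigma$ $$d_{p(A)}(p(g)p(U),p(g')p(U))\ \le\ d_A(gU,g'U)\ \le\ k\, d_{p(A)}(p(g)p(U),p(g')p(U))+\epsilon_0 .$$ -/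

import Mathlib

open scoped Pointwise

universe u v w

/-! ## Graphs as metric spaces: hyperbolicity and the Gromov boundary -/

namespace SimpleGraph

variable {V : Type u} (X : SimpleGraph V)

/-- Gromov hyperbolicity of a (connected) graph: the four point condition for the path metric
on the vertices. The vertices are `1/2`-dense in the geometric realisation, so this is
the same as hyperbolicity of the geometric realisation, with another constant. -/
def IsGromovHyperbolic : Prop :=
  ∃ δ : ℝ, 0 ≤ δ ∧ ∀ x y z t : V,
    (X.dist x z : ℝ) + X.dist y t ≤
      max ((X.dist x y : ℝ) + X.dist z t) ((X.dist x t : ℝ) + X.dist y z) + 2 * δ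

/-- A geodesic ray starting at the vertex `x₀`, given by the sequence of its vertices. -/
structure GeodesicRay (x₀ : V) where
  toFun : ℕ → V
  start : toFun 0 = x₀
  geodesic : ∀ m n : ℕ, X.edist (toFun m) (toFun n) = (Nat.dist m n : ℕ∞)

/-- `S` is contained in a bounded neighbourhood of `T` for the path metric. -/
def InBoundedNhd (S T : Set V) : Prop :=
  ∃ D : ℕ, ∀ s ∈ S, ∃ t ∈ T, X.edist s t ≤ (D : ℕ∞)

lemma InBoundedNhd.trans {S T W : Set V} (h : X.InBoundedNhd S T) (h' : X.InBoundedNhd T W) :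
    X.InBoundedNhd S W := by
  obtain ⟨D, hD⟩ := h
  obtain ⟨E, hE⟩ := h'
  refine ⟨D + E, fun s hs => ?_⟩
  obtain ⟨t, ht, hst⟩ := hD s hs
  obtain ⟨w, hw, htw⟩ := hE t ht
  refine ⟨w, hw, (SimpleGraph.edist_triangle (v := t)).trans ?_⟩
  push_cast
  exact add_le_add hst htw

/-- Two geodesic rays are equivalent if their Hausdorff distance is finite. -/
def raySetoid (x₀ : V) : Setoid (X.GeodesicRay x₀) where
  r γ γ' := X.InBoundedNhd (Set.range γ.toFun) (Set.range γ'.toFun) ∧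
    X.InBoundedNhd (Set.range γ'.toFun) (Set.range γ.toFun)
  iseqv :=
    { refl := fun γ => ⟨⟨0, fun s hs => ⟨s, hs, by simp⟩⟩, ⟨0, fun s hs => ⟨s, hs, by simp⟩⟩⟩
      symm := fun h => ⟨h.2, h.1⟩
      trans := fun h h' => ⟨h.1.trans X h'.1, h'.2.trans X h.2⟩ }

/-- The Gromov boundary: equivalence classes of geodesic rays starting at `x₀`. -/
def GromovBoundary (x₀ : V) : Type u := Quotient (X.raySetoid x₀)

end SimpleGraph

/-! ## Compactly generated groups, Cayley-Abels graphs, hyperbolic groups -/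

section Groups

variable (G : Type u) [Group G] [TopologicalSpace G]

/-- `K` is a compact generating set of `G`. -/
def IsCompactGeneratingSet {G : Type u} [Group G] [TopologicalSpace G] (K : Set G) : Prop :=
  IsCompact K ∧ Subgroup.closure K = ⊤

/-- `G` is compactly generated. -/
def IsCompactlyGeneratedGroup : Prop :=
  ∃ K : Set G, IsCompactGeneratingSet K

/-- `X` is a Cayley-Abels graph of `G`: a locally finite connected graph on which `G` acts
(by graph automorphisms) vertex transitively with compact open vertex stabilisers. -/
structure IsCayleyAbelsGraph {V : Type v} [MulAction G V] (X : SimpleGraph V) : Prop where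
  connected : X.Connected
  locallyFinite : ∀ x : V, (X.neighborSet x).Finite
  adj_smul : ∀ (g : G) (x y : V), X.Adj (g • x) (g • y) ↔ X.Adj x y
  transitive : MulAction.IsPretransitive G V
  isOpen_stabilizer : ∀ x : V, IsOpen (MulAction.stabilizer G x : Set G)
  isCompact_stabilizer : ∀ x : V, IsCompact (MulAction.stabilizer G x : Set G)

/-- A compactly generated group is non-elementary hyperbolic if some Cayley-Abels graph of it is
Gromov hyperbolic and its Gromov boundary has at least three points. (A vertex set with a
transitive action of `G` is a set of cosets, so it is enough to look at vertex sets in the universe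
of `G`.) -/
def IsNonElementaryHyperbolic : Prop :=
  IsCompactlyGeneratedGroup G ∧
    ∃ (V : Type u) (_ : MulAction G V) (X : SimpleGraph V),
      IsCayleyAbelsGraph G X ∧ X.IsGromovHyperbolic ∧
        ∃ x₀ : V, 3 ≤ ENat.card (X.GromovBoundary x₀)

end Groups

/-! ## The Cayley-Abels graph `Γ_G(K, U, A)` and its word metric -/

section CosetGraph

variable {G : Type u} [Group G]

/-- The data `(K, U, A)` of a Cayley-Abels graph `Γ_G(K, U, A)`: a compact generating set `K`, a
compact open subgroup `U`, and a finite symmetric set `A` containing `1` with `K ⊆ AU`,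
`UAU = AU` and `G = ⟨A⟩U`. -/
structure IsCayleyAbelsData [TopologicalSpace G] (K : Set G) (U : Subgroup G) (A : Set G) :
    Prop where
  generating : IsCompactGeneratingSet K
  isOpen : IsOpen (U : Set G)
  isCompact : IsCompact (U : Set G)
  finite : A.Finite
  symmetric : A⁻¹ = A
  one_mem : (1 : G) ∈ A
  subset_mul : K ⊆ A * (U : Set G)
  mul_mul : (U : Set G) * A * (U : Set G) = A * (U : Set G)
  closure_mul : (Subgroup.closure A : Set G) * (U : Set G) = Set.univ

/-- The graph `Γ_G(K, U, A)`: its vertices are the cosets `gU`, its edges are the `{gU, gaU}` with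
`g ∈ G` and `a ∈ A` (those with `gU = gaU` are discarded). -/
def cayleyAbelsGraph (U : Subgroup G) (A : Set G) : SimpleGraph (G ⧸ U) :=
  SimpleGraph.fromRel fun x y => ∃ g : G, ∃ a ∈ A, (g : G ⧸ U) = x ∧ ((g * a : G) : G ⧸ U) = y

/-- The word metric `d_A(gU, g'U) = min {n : g⁻¹g'U = a₁a₂⋯aₙU for some a₁, …, aₙ ∈ A}`. -/
noncomputable def wordDist (U : Subgroup G) (A : Set G) (g g' : G) : ℕ :=
  sInf {n : ℕ | ∃ l : List G, l.length = n ∧ (∀ a ∈ l, a ∈ A) ∧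
    ((g⁻¹ * g' : G) : G ⧸ U) = (l.prod : G ⧸ U)}

lemma adj_cayleyAbelsGraph {U : Subgroup G} {A : Set G} (hA : A⁻¹ = A) {x y : G ⧸ U} :
    (cayleyAbelsGraph U A).Adj x y ↔
      x ≠ y ∧ ∃ g : G, ∃ a ∈ A, (g : G ⧸ U) = x ∧ ((g * a : G) : G ⧸ U) = y := by
  rw [cayleyAbelsGraph, SimpleGraph.fromRel_adj]
  refine and_congr_right fun _ => ⟨?_, Or.inl⟩
  rintro (h | ⟨g, a, ha, h1, h2⟩)
  · exact h
  · refine ⟨g * a, a⁻¹, ?_, h2, by simpa using h1⟩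
    rw [← hA]
    simpa using ha

/-- If `UAU = AU`, words in `A` can be moved across `U`. -/
lemma exists_word_of_mul {U : Subgroup G} {A : Set G}
    (h : (U : Set G) * A * (U : Set G) = A * (U : Set G)) (l : List G) :
    (∀ a ∈ l, a ∈ A) → ∀ u ∈ U, ∃ l' : List G, l'.length = l.length ∧ (∀ a ∈ l', a ∈ A) ∧
      ((u * l.prod : G) : G ⧸ U) = (l'.prod : G ⧸ U) := by
  induction l with
  | nil => exact fun _ u hu => ⟨[], rfl, by simp, by simpa [QuotientGroup.eq] using hu⟩
  | cons a l ih =>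
    intro hl u hu
    have hm : u * a * 1 ∈ A * (U : Set G) :=
      h ▸ Set.mul_mem_mul (Set.mul_mem_mul hu (hl a (by simp))) U.one_mem
    obtain ⟨b, hb, u', hu', hbu⟩ := hm
    obtain ⟨l', hlen, hl', hprod⟩ := ih (fun c hc => hl c (by simp [hc])) u' hu'
    refine ⟨b :: l', by simp [hlen], ?_, ?_⟩
    · intro c hc
      rcases List.mem_cons.1 hc with rfl | hc
      exacts [hb, hl' c hc]
    · simp only [mul_one] at hbu
      rw [List.prod_cons, List.prod_cons, ← mul_assoc, ← hbu, mul_assoc]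
      rw [QuotientGroup.eq] at hprod ⊢
      simpa [mul_assoc] using hprod

/-- The word metric is the path metric of the graph `Γ_G(K, U, A)`. -/
theorem dist_cayleyAbelsGraph [TopologicalSpace G] {K : Set G} {U : Subgroup G} {A : Set G}
    (h : IsCayleyAbelsData K U A) (g g' : G) :
    (cayleyAbelsGraph U A).Reachable (g : G ⧸ U) (g' : G ⧸ U) ∧
      (cayleyAbelsGraph U A).dist (g : G ⧸ U) (g' : G ⧸ U) = wordDist U A g g' := by
  set X := cayleyAbelsGraph U A with hX
  have key1 : ∀ (l : List G), (∀ a ∈ l, a ∈ A) → ∀ b : G,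
      ∃ q : X.Walk (b : G ⧸ U) ((b * l.prod : G) : G ⧸ U), q.length ≤ l.length := by
    intro l
    induction l with
    | nil => exact fun _ b => ⟨SimpleGraph.Walk.nil.copy rfl (by simp), by rw [SimpleGraph.Walk.length_copy]; simp⟩
    | cons a l ih =>
      intro hl b
      obtain ⟨q, hq⟩ := ih (fun c hc => hl c (by simp [hc])) (b * a)
      by_cases hba : (b : G ⧸ U) = ((b * a : G) : G ⧸ U)
      · exact ⟨q.copy hba.symm (by simp [mul_assoc]), by simp; omega⟩
      · have hadj : X.Adj (b : G ⧸ U) ((b * a : G) : G ⧸ U) :=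
          (adj_cayleyAbelsGraph h.symmetric).2 ⟨hba, b, a, hl a (by simp), rfl, rfl⟩
        exact ⟨(SimpleGraph.Walk.cons hadj q).copy rfl (by simp [mul_assoc]), by simp; omega⟩
  have key2 : ∀ (x y : G ⧸ U) (q : X.Walk x y) (b b' : G), (b : G ⧸ U) = x → (b' : G ⧸ U) = y →
      ∃ l : List G, l.length = q.length ∧ (∀ a ∈ l, a ∈ A) ∧
        ((b⁻¹ * b' : G) : G ⧸ U) = (l.prod : G ⧸ U) := by
    intro x y q
    induction q with
    | nil =>
      intro b b' hb hb'
      refine ⟨[], rfl, by simp, ?_⟩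
      have := hb.trans hb'.symm
      rw [QuotientGroup.eq] at this ⊢
      simpa using U.inv_mem this
    | cons hadj q ih =>
      intro b b' hb hb'
      obtain ⟨-, c, a, ha, hc, hca⟩ := (adj_cayleyAbelsGraph h.symmetric).1 hadj
      obtain ⟨l, hlen, hl, hprod⟩ := ih (c * a) b' hca hb'
      have hbc := hb.trans hc.symm
      rw [QuotientGroup.eq] at hbc
      obtain ⟨l', hlen', hl', hprod'⟩ := exists_word_of_mul h.mul_mul (a :: l)
        (by
          intro d hd
          rcases List.mem_cons.1 hd with rfl | hd
          exacts [ha, hl d hd]) (b⁻¹ * c) hbc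
      refine ⟨l', by simp [hlen', hlen], hl', ?_⟩
      rw [← hprod']
      rw [QuotientGroup.eq] at hprod ⊢
      simpa [mul_assoc] using hprod
  have hne : ∃ n, n ∈ {n : ℕ | ∃ l : List G, l.length = n ∧ (∀ a ∈ l, a ∈ A) ∧
      ((g⁻¹ * g' : G) : G ⧸ U) = (l.prod : G ⧸ U)} := by
    have hmem : g⁻¹ * g' ∈ (Subgroup.closure A : Set G) * (U : Set G) := h.closure_mul ▸ trivial
    obtain ⟨c, hc, u, hu, hcu⟩ := hmem
    rw [SetLike.mem_coe, ← Subgroup.mem_toSubmonoid, Subgroup.closure_toSubmonoid] at hc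
    obtain ⟨l, hl, hprod⟩ := Submonoid.exists_list_of_mem_closure hc
    refine ⟨l.length, l, rfl, fun a ha => ?_, ?_⟩
    · rcases hl a ha with h' | h'
      · exact h'
      · rw [← h.symmetric]
        exact h'
    · rw [hprod, ← hcu, QuotientGroup.eq]
      simpa using hu
  obtain ⟨l, hlen, hl, hprod⟩ := Nat.sInf_mem hne
  obtain ⟨q, hq⟩ := key1 l hl g
  have hend : ((g * l.prod : G) : G ⧸ U) = (g' : G ⧸ U) := by
    rw [QuotientGroup.eq] at hprod ⊢
    simpa [mul_assoc] using U.inv_mem hprod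
  have hr : X.Reachable (g : G ⧸ U) (g' : G ⧸ U) := ⟨q.copy rfl hend⟩
  refine ⟨hr, le_antisymm ?_ ?_⟩
  · have := SimpleGraph.dist_le (q.copy rfl hend)
    rw [SimpleGraph.Walk.length_copy] at this
    exact this.trans (hq.trans hlen.le)
  · obtain ⟨q', hq'⟩ := hr.exists_walk_length_eq_dist
    obtain ⟨l', hlen', hl', hprod'⟩ := key2 _ _ q' g g' rfl rfl
    exact Nat.sInf_le ⟨l', hlen'.trans hq', hl', hprod'⟩

/-- The graph `Γ_G(K, U, A)` is a Cayley-Abels graph of `G`. -/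
theorem isCayleyAbelsGraph_cayleyAbelsGraph [TopologicalSpace G] [IsTopologicalGroup G]
    {K : Set G} {U : Subgroup G} {A : Set G} (h : IsCayleyAbelsData K U A) :
    IsCayleyAbelsGraph G (cayleyAbelsGraph U A) where
  connected :=
    { preconnected := fun x y => by
        induction x using QuotientGroup.induction_on with | H g => ?_
        induction y using QuotientGroup.induction_on with | H g' => ?_
        exact (dist_cayleyAbelsGraph h g g').1
      nonempty := ⟨((1 : G) : G ⧸ U)⟩ }
  locallyFinite x := by
    induction x using QuotientGroup.induction_on with | H g => ?_
    refine (h.finite.image fun a => ((g * a : G) : G ⧸ U)).subset ?_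
    intro y hy
    obtain ⟨-, c, a, ha, hc, rfl⟩ := (adj_cayleyAbelsGraph h.symmetric).1 hy
    have hgc := hc.symm
    rw [QuotientGroup.eq] at hgc
    have hm : g⁻¹ * c * a * 1 ∈ A * (U : Set G) :=
      h.mul_mul ▸ Set.mul_mem_mul (Set.mul_mem_mul hgc ha) U.one_mem
    obtain ⟨b, hb, u, hu, hbu⟩ := hm
    refine ⟨b, hb, ?_⟩
    simp only [mul_one] at hbu
    have : c * a = g * b * u := by rw [mul_assoc g, hbu]; group
    rw [QuotientGroup.eq, this]
    simpa [mul_assoc] using hu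
  adj_smul := by
    have key : ∀ (g : G) (x y : G ⧸ U), (cayleyAbelsGraph U A).Adj x y →
        (cayleyAbelsGraph U A).Adj (g • x) (g • y) := by
      intro g x y hxy
      obtain ⟨hne, c, a, ha, rfl, rfl⟩ := (adj_cayleyAbelsGraph h.symmetric).1 hxy
      refine (adj_cayleyAbelsGraph h.symmetric).2 ⟨fun he => hne (smul_left_cancel g he), g * c, a, ha, rfl, ?_⟩
      rw [mul_assoc]
      rfl
    exact fun g x y => ⟨fun hxy => by simpa using key g⁻¹ _ _ hxy, key g x y⟩
  transitive := inferInstance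
  isOpen_stabilizer x := by
    induction x using QuotientGroup.induction_on with | H g => ?_
    have : (MulAction.stabilizer G (g : G ⧸ U) : Set G) = (fun c => g⁻¹ * c * g) ⁻¹' (U : Set G) := by
      ext c
      rw [SetLike.mem_coe, MulAction.mem_stabilizer_iff, eq_comm, MulAction.Quotient.smul_coe,
        QuotientGroup.eq]
      simp [mul_assoc]
    rw [this]
    exact h.isOpen.preimage (by fun_prop)
  isCompact_stabilizer x := by
    induction x using QuotientGroup.induction_on with | H g => ?_
    have : (MulAction.stabilizer G (g : G ⧸ U) : Set G) = (fun c => g * c * g⁻¹) '' (U : Set G) := by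
      ext c
      rw [SetLike.mem_coe, MulAction.mem_stabilizer_iff, eq_comm, MulAction.Quotient.smul_coe,
        QuotientGroup.eq]
      refine ⟨fun hc => ⟨g⁻¹ * c * g, by simpa [mul_assoc] using hc, by group⟩, ?_⟩
      rintro ⟨d, hd, rfl⟩
      simpa [mul_assoc] using hd
    rw [this]
    exact h.isCompact.image (by fun_prop)

/-- Under an open continuous surjection, the images of `K`, `U`, `A` are again the data of a
Cayley-Abels graph. -/
theorem IsCayleyAbelsData.map [TopologicalSpace G] {Q : Type v} [Group Q] [TopologicalSpace Q]
    {K : Set G} {U : Subgroup G} {A : Set G} (h : IsCayleyAbelsData K U A) (p : G →* Q)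
    (hp : Continuous p) (hp' : IsOpenMap p) (hs : Function.Surjective p) :
    IsCayleyAbelsData (p '' K) (U.map p) (p '' A) where
  generating := ⟨h.generating.1.image hp, by
    rw [← MonoidHom.map_closure, h.generating.2, Subgroup.map_top_of_surjective p hs]⟩
  isOpen := by simpa using hp' _ h.isOpen
  isCompact := by simpa using h.isCompact.image hp
  finite := h.finite.image p
  symmetric := by rw [← Set.image_inv p, h.symmetric]
  one_mem := ⟨1, h.one_mem, map_one p⟩
  subset_mul := by
    rw [Subgroup.coe_map, ← Set.image_mul p]
    exact Set.image_mono h.subset_mul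
  mul_mul := by rw [Subgroup.coe_map, ← Set.image_mul p, ← Set.image_mul p, ← Set.image_mul p, h.mul_mul]
  closure_mul := by
    rw [← MonoidHom.map_closure, Subgroup.coe_map, Subgroup.coe_map, ← Set.image_mul p,
      h.closure_mul, Set.image_univ, hs.range_eq]

end CosetGraph

/-- `S` is a quasiisometric section of `p : G → Q` with respect to the Cayley-Abels graphs
`Γ_G(K, U, A)` and `Γ_Q(p(K), p(U), p(A))`. -/
def IsQuasiisometricSection {G : Type u} {Q : Type v} [Group G] [Group Q] (p : G →* Q)
    (U : Subgroup G) (A : Set G) (S : Set (G ⧸ U)) : Prop :=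
  {x : Q ⧸ U.map p | ∃ g : G, (g : G ⧸ U) ∈ S ∧ (p g : Q ⧸ U.map p) = x} = Set.univ ∧
    ∃ k ε : ℝ, 1 ≤ k ∧ 0 ≤ ε ∧ ∀ g g' : G, (g : G ⧸ U) ∈ S → (g' : G ⧸ U) ∈ S →
      1 / k * (wordDist (U.map p) (p '' A) (p g) (p g') : ℝ) - ε ≤ (wordDist U A g g' : ℝ) ∧
      (wordDist U A g g' : ℝ) ≤ k * (wordDist (U.map p) (p '' A) (p g) (p g') : ℝ) + ε

/-! `G` acts on `H` by conjugation. Read through the orbit map of a vertex `x₀` of a Cayley–Abels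
graph of `H`, each conjugation is a quasiisometry, with constants uniform over compact subsets of
`G` (`exists_quasiisometry_conjRange`). Three distinct boundary points of `H` give three rays whose
triangles have `x₀` as a coarse center. By stability of quasigeodesics, conjugation by `g` carries
this triple to one that again has a coarse center, unique up to bounded error. Conjugation by `h ∈
H` differs from left translation by `h` only by a bounded amount on the orbit, so it translates
centers by `h`.

Let `S` consist of the `g` for which `g⁻¹` carries the triple to one centered at `x₀`. Since `H` is
transitive on vertices, `S` meets every coset `gH`. If `g` and `g' = g h b` lie in `S` with `b` in a
compact set, comparing centers shows that `h⁻¹ x₀` is close to `x₀`, so `g⁻¹ g' = h b` stays in a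
compact set (`exists_coarse_section`). A word in `Q` is then lifted letter by letter through `S` at
bounded cost per letter, while `p` itself is 1-Lipschitz.

Boundary triples are handled as triples of vertex sequences, and centers are taken for almost all
indices of a nonprincipal ultrafilter. No action on the boundary and no passage to subsequences is
needed. -/

/-! ## Gromov products in hyperbolic pseudometric spaces -/

section GromovProduct

variable {M : Type*} [PseudoMetricSpace M]

/-- The Gromov product of `x` and `y` with respect to `p`. -/
noncomputable def gromovProduct (x y p : M) : ℝ := (dist p x + dist p y - dist x y) / 2

lemma gromovProduct_comm (x y p : M) : gromovProduct x y p = gromovProduct y x p := by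
  unfold gromovProduct
  rw [dist_comm x y]
  ring

lemma gromovProduct_self (x p : M) : gromovProduct x x p = dist p x := by
  unfold gromovProduct
  rw [dist_self]
  ring

lemma gromovProduct_le_dist_right (x y p : M) : gromovProduct x y p ≤ dist p y := by
  unfold gromovProduct
  linarith [dist_triangle p y x, dist_comm x y]

lemma sub_dist_le_gromovProduct (x y p : M) : dist p x - dist x y ≤ gromovProduct x y p := by
  unfold gromovProduct
  linarith [dist_triangle p y x, dist_comm x y]

lemma gromovProduct_le_add_dist (x y p x' y' p' : M) :
    gromovProduct x y p ≤ gromovProduct x' y' p' + dist x x' + dist y y' + dist p p' := by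
  unfold gromovProduct
  linarith [dist_triangle p p' x, dist_triangle p' x' x, dist_triangle p p' y,
    dist_triangle p' y' y, dist_triangle x' x y', dist_triangle x y y', dist_comm x x',
    dist_comm y y']

/-- The four point condition. -/
def IsFourPointHyperbolic (M : Type*) [PseudoMetricSpace M] (δ : ℝ) : Prop :=
  ∀ x y z t : M, dist x z + dist y t ≤ max (dist x y + dist z t) (dist x t + dist y z) + 2 * δ

/-- Any two points are joined by a discrete geodesic. -/
def IsDiscretelyGeodesic (M : Type*) [PseudoMetricSpace M] : Prop :=
  ∀ x y : M, ∃ (L : ℕ) (γ : ℕ → M), γ 0 = x ∧ γ L = y ∧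
    ∀ s ≤ L, ∀ t ≤ L, dist (γ s) (γ t) = |(s : ℝ) - t|

variable {δ : ℝ}

/-- The four point condition with `p` as fourth point is `(x|z) ≥ min (x|y) (y|z) - δ`; the
threshold `s` stands for the minimum. -/
lemma IsFourPointHyperbolic.le_gromovProduct (h : IsFourPointHyperbolic M δ) {x y z p : M} {s : ℝ}
    (hxy : s ≤ gromovProduct x y p) (hyz : s ≤ gromovProduct y z p) :
    s - δ ≤ gromovProduct x z p := by
  have := h x y z p
  unfold gromovProduct at *
  rw [dist_comm p x, dist_comm p y, dist_comm p z] at *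
  rcases max_cases (dist x y + dist z p) (dist x p + dist y z) with ⟨h1, _⟩ | ⟨h1, _⟩ <;>
    rw [h1] at this <;> linarith

/-- Halving the chain repeatedly makes the loss logarithmic in its length. The condition on `(x i|x
i)`, the distance from `p` to `x i`, covers the degenerate chain `a = b`. -/
lemma IsFourPointHyperbolic.le_gromovProduct_of_chain (h : IsFourPointHyperbolic M δ) {x : ℕ → M}
    {p : M} {s : ℝ} (j : ℕ) : ∀ a b : ℕ, a ≤ b → b ≤ a + 2 ^ j →
      (∀ i, a ≤ i → i ≤ b → s ≤ gromovProduct (x i) (x i) p) →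
      (∀ i, a ≤ i → i < b → s ≤ gromovProduct (x i) (x (i + 1)) p) → 0 ≤ δ →
      s - j * δ ≤ gromovProduct (x a) (x b) p := by
  induction j with
  | zero =>
    intro a b hab hb h0 h1 hδ
    obtain rfl | rfl : b = a ∨ b = a + 1 := by omega
    · simpa using h0 b le_rfl le_rfl
    · simpa using h1 a le_rfl (by omega)
  | succ j ih =>
    intro a b hab hb h0 h1 hδ
    rw [pow_succ] at hb
    obtain ⟨m, ham, hmb, hm1, hm2⟩ : ∃ m, a ≤ m ∧ m ≤ b ∧ m ≤ a + 2 ^ j ∧ b ≤ m + 2 ^ j := by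
      rcases le_total b (a + 2 ^ j) with h' | h'
      · exact ⟨b, hab, le_rfl, h', by omega⟩
      · exact ⟨a + 2 ^ j, by omega, h', le_rfl, by omega⟩
    have e1 := ih a m ham hm1 (fun i hi hi' => h0 i hi (by omega))
      (fun i hi hi' => h1 i hi (by omega)) hδ
    have e2 := ih m b hmb hm2 (fun i hi hi' => h0 i (by omega) hi')
      (fun i hi hi' => h1 i (by omega) hi') hδ
    have := h.le_gromovProduct e1 e2
    push_cast
    linarith

/-! ## Stability of quasigeodesics -/

/-- `f` is a discrete quasigeodesic on `{0, …, n}` with constant `k`. -/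
structure IsDiscreteQuasigeodesic (f : ℕ → M) (n : ℕ) (k : ℝ) : Prop where
  dist_le : ∀ i ≤ n, ∀ j ≤ n, dist (f i) (f j) ≤ k * |(i : ℝ) - j| + k
  le_dist : ∀ i ≤ n, ∀ j ≤ n, |(i : ℝ) - j| ≤ k * dist (f i) (f j) + k

/-- A quantity bounded linearly by the square root of itself is bounded. In the stability theorem
the square root is a convenient majorant of the logarithmic loss along a chain. -/
lemma exists_bound_of_le_sqrt {α β a b : ℝ} (hα : 0 ≤ α) (hβ : 0 ≤ β) (ha : 0 ≤ a) (hb : 0 ≤ b) :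
    ∃ R : ℝ, ∀ (D : ℝ) (s : ℕ), D ≤ α * s + β → (s : ℝ) * s ≤ a * D + b → D ≤ R := by
  refine ⟨α * (a * α + (a * β + b) + 1) + β, fun D s h1 h2 => ?_⟩
  have hs : (0 : ℝ) ≤ s := s.cast_nonneg
  have h3 : (s : ℝ) * s ≤ a * α * s + (a * β + b) := by nlinarith
  have h4 : (s : ℝ) ≤ a * α + (a * β + b) + 1 := by
    by_contra! hcon
    have : 0 ≤ a * α := by positivity
    have : 0 ≤ a * β + b := by positivity
    nlinarith
  nlinarith

/-- The geodesic with the same end points stays close to a quasigeodesic. -/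
theorem exists_geodesic_near_quasigeodesic (h : IsFourPointHyperbolic M δ) (hδ : 0 ≤ δ) {k : ℝ}
    (hk : 0 ≤ k) : ∃ R : ℝ, 0 ≤ R ∧ ∀ (f : ℕ → M) (n : ℕ), IsDiscreteQuasigeodesic f n k →
      ∀ (L : ℕ) (γ : ℕ → M), γ 0 = f 0 → γ L = f n →
        (∀ s ≤ L, ∀ t ≤ L, dist (γ s) (γ t) = |(s : ℝ) - t|) →
        ∀ t ≤ L, ∃ i ≤ n, dist (γ t) (f i) ≤ R := by
  obtain ⟨R, hR⟩ := exists_bound_of_le_sqrt (α := 2 * δ) (β := 4 * δ + 2 * k) (a := 6 * k)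
    (b := 3 * k) (by positivity) (by positivity) (by positivity) (by positivity)
  refine ⟨max R 0, le_max_right _ _, fun f n hf L γ h0 hL hγ => ?_⟩
  have hmin : ∀ t, ∃ i ≤ n, ∀ j ≤ n, dist (γ t) (f i) ≤ dist (γ t) (f j) := by
    intro t
    obtain ⟨i, hi, hi'⟩ := Finset.exists_min_image (Finset.range (n + 1))
      (fun i => dist (γ t) (f i)) ⟨0, by simp⟩
    refine ⟨i, by simpa [Nat.lt_succ_iff] using hi, fun j hj => hi' j ?_⟩
    simpa [Nat.lt_succ_iff] using hj
  choose e he he' using hmin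
  obtain ⟨t₀, ht₀, hmax⟩ := Finset.exists_max_image (Finset.range (L + 1))
      (fun t => dist (γ t) (f (e t))) ⟨0, by simp⟩
  replace ht₀ : t₀ ≤ L := by simpa [Nat.lt_succ_iff] using ht₀
  set D := dist (γ t₀) (f (e t₀)) with hD
  have hD0 : 0 ≤ D := dist_nonneg
  replace hmax : ∀ t ≤ L, dist (γ t) (f (e t)) ≤ D := fun t ht =>
    hmax t (by simpa [Nat.lt_succ_iff] using ht)
  suffices D ≤ R from fun t ht => ⟨e t, he t, (hmax t ht).trans (this.trans (le_max_left _ _))⟩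
  set p := γ t₀ with hp
  have hfar : ∀ i ≤ n, D ≤ dist p (f i) := he' t₀
  -- At distance `2 * D` from `p`, a point within `D` of the path is joined to it by a pair with
  -- Gromov product at least `D` at `p`. If the geodesic ends earlier, its end point lies on the
  -- path.
  set c := ⌈2 * D⌉₊ with hc
  have hc1 : 2 * D ≤ c := Nat.le_ceil _
  have hc2 : (c : ℝ) ≤ 2 * D + 1 := (Nat.ceil_lt_add_one (by positivity)).le
  have hside : ∀ t ≤ L, (t = 0 ∨ t = L ∨ (c : ℝ) ≤ dist p (γ t)) → ∃ i ≤ n,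
      dist (γ t) (f i) ≤ D ∧ D ≤ gromovProduct (γ t) (f i) p := by
    rintro t ht (rfl | rfl | hct)
    · exact ⟨0, Nat.zero_le _, by simpa [h0] using hD0, by
        rw [h0, gromovProduct_self]; exact hfar 0 (Nat.zero_le _)⟩
    · exact ⟨n, le_rfl, by simpa [hL] using hD0, by
        rw [hL, gromovProduct_self]; exact hfar n le_rfl⟩
    · refine ⟨e t, he t, hmax t ht, ?_⟩
      have := sub_dist_le_gromovProduct (γ t) (f (e t)) p
      linarith [hmax t ht]
  obtain ⟨i₁, hi₁, hd₁, hg₁⟩ := hside (t₀ - c) (by omega) (by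
    rcases le_total t₀ c with hle | hle
    · left; omega
    · right; right
      rw [hp, hγ _ ht₀ _ (by omega), Nat.cast_sub hle]
      simp)
  obtain ⟨i₂, hi₂, hd₂, hg₂⟩ := hside (min L (t₀ + c)) (by omega) (by
    rcases le_total L (t₀ + c) with hle | hle
    · right; left; omega
    · right; right
      rw [min_eq_right hle, hp, hγ _ ht₀ _ hle]
      push_cast
      simp)
  have hl : ((t₀ - c : ℕ) : ℝ) ≤ t₀ := by exact_mod_cast Nat.sub_le _ _
  have hl' : (t₀ : ℝ) - c ≤ ((t₀ - c : ℕ) : ℝ) := by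
    rw [sub_le_iff_le_add]; exact_mod_cast (by omega : t₀ ≤ (t₀ - c) + c)
  have hr : (t₀ : ℝ) ≤ ((min L (t₀ + c) : ℕ) : ℝ) := by exact_mod_cast (by omega)
  have hr' : ((min L (t₀ + c) : ℕ) : ℝ) ≤ t₀ + c := by exact_mod_cast (by omega)
  have hy : dist (γ (t₀ - c)) (γ (min L (t₀ + c))) ≤ 2 * c := by
    rw [hγ _ (by omega) _ (by omega), abs_le]
    constructor <;> linarith
  -- The point `p` lies on the geodesic, so this product vanishes; the detour along `f`, which stays
  -- `D` away from `p`, bounds it below by `D` minus a small loss.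
  have hzero : gromovProduct (γ (t₀ - c)) (γ (min L (t₀ + c))) p = 0 := by
    unfold gromovProduct
    rw [hp, hγ _ ht₀ _ (by omega), hγ _ ht₀ _ (by omega), hγ _ (by omega) _ (by omega),
      abs_of_nonneg (by linarith), abs_of_nonpos (by linarith), abs_of_nonpos (by linarith)]
    ring
  have hff : dist (f i₁) (f i₂) ≤ 6 * D + 2 := by
    have h1 := dist_triangle (f i₁) (γ (t₀ - c)) (f i₂)
    have h2 := dist_triangle (γ (t₀ - c)) (γ (min L (t₀ + c))) (f i₂)
    rw [dist_comm (f i₁) (γ (t₀ - c))] at h1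
    linarith
  have hidx : |(i₁ : ℝ) - i₂| ≤ k * (6 * D + 2) + k :=
    (hf.le_dist _ hi₁ _ hi₂).trans (by gcongr)
  -- A chain of fewer than `(s + 1)²` steps has at most `2 ^ (2 * (s + 1))` of them; consecutive
  -- points are at distance at most `2 * k`.
  have hchain : ∀ a b s : ℕ, a ≤ b → b ≤ n → b - a < (s + 1) * (s + 1) →
      D - 2 * k - (2 * (s + 1) : ℕ) * δ ≤ gromovProduct (f a) (f b) p := by
    intro a b s hab hb hs
    refine h.le_gromovProduct_of_chain _ a b hab ?_ ?_ ?_ hδ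
    · have h1 : s + 1 < 2 ^ (s + 1) := Nat.lt_two_pow_self
      have h2 : 2 ^ (2 * (s + 1)) = 2 ^ (s + 1) * 2 ^ (s + 1) := by rw [two_mul, pow_add]
      have h3 : (s + 1) * (s + 1) ≤ 2 ^ (s + 1) * 2 ^ (s + 1) := Nat.mul_le_mul h1.le h1.le
      omega
    · intro i _ hi
      rw [gromovProduct_self]
      linarith [hfar i (hi.trans hb)]
    · intro i _ hi
      have h1 := sub_dist_le_gromovProduct (f i) (f (i + 1)) p
      have h2 := hf.dist_le i (by omega) (i + 1) (by omega)
      have h3 : |(i : ℝ) - (i + 1 : ℕ)| = 1 := by push_cast; simp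
      rw [h3] at h2
      linarith [hfar i (by omega)]
  obtain ⟨s, hs, hgs⟩ : ∃ s : ℕ, (s : ℝ) * s ≤ |(i₁ : ℝ) - i₂| ∧
      D - 2 * k - (2 * (s + 1) : ℕ) * δ ≤ gromovProduct (f i₁) (f i₂) p := by
    rcases le_total i₁ i₂ with hle | hle
    · refine ⟨Nat.sqrt (i₂ - i₁), ?_, hchain _ _ _ hle hi₂ (Nat.lt_succ_sqrt _)⟩
      rw [abs_sub_comm, ← Nat.cast_sub hle, abs_of_nonneg (Nat.cast_nonneg _)]
      exact_mod_cast Nat.sqrt_le _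
    · refine ⟨Nat.sqrt (i₁ - i₂), ?_, ?_⟩
      · rw [← Nat.cast_sub hle, abs_of_nonneg (Nat.cast_nonneg _)]
        exact_mod_cast Nat.sqrt_le _
      · rw [gromovProduct_comm]
        exact hchain _ _ _ hle hi₁ (Nat.lt_succ_sqrt _)
  refine hR D s ?_ (by nlinarith)
  have hs0 : 0 ≤ ((2 * (s + 1) : ℕ) : ℝ) * δ := by positivity
  have e1 := h.le_gromovProduct (s := D - 2 * k - (2 * (s + 1) : ℕ) * δ) (by linarith) hgs
  have e2 := h.le_gromovProduct (s := D - 2 * k - (2 * (s + 1) : ℕ) * δ - δ)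
    (z := γ (min L (t₀ + c))) e1 (by rw [gromovProduct_comm]; linarith)
  rw [hzero] at e2
  push_cast at e2
  linarith

/-- A quasigeodesic stays close to the geodesics with the same end points. -/
theorem exists_gromovProduct_quasigeodesic_le (h : IsFourPointHyperbolic M δ) (hδ : 0 ≤ δ)
    (hgeo : IsDiscretelyGeodesic M) {k : ℝ} (hk : 0 ≤ k) :
    ∃ R : ℝ, ∀ (f : ℕ → M) (n : ℕ), IsDiscreteQuasigeodesic f n k →
      ∀ i ≤ n, gromovProduct (f 0) (f n) (f i) ≤ R := by
  obtain ⟨R, hR0, hR⟩ := exists_geodesic_near_quasigeodesic h hδ hk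
  refine ⟨k * (k * (2 * R + 1) + k) + k + R, fun f n hf i hi => ?_⟩
  obtain ⟨L, γ, h0, hL, hγ⟩ := hgeo (f 0) (f n)
  have hnear := hR f n hf L γ h0 hL hγ
  -- If the path is nearly pinched at times `i' ≤ i ≤ i''`, the time gap is bounded, and so is the
  -- distance from `f i` to `f i'`.
  have key : ∀ i' ≤ i, ∀ i'' ≤ n, i ≤ i'' → dist (f i') (f i'') ≤ 2 * R + 1 →
      dist (f i) (f i') ≤ k * (k * (2 * R + 1) + k) + k := by
    intro i' hi' i'' hi'' hii hd
    refine (hf.dist_le i hi i' (by omega)).trans ?_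
    gcongr
    refine le_trans ?_ ((hf.le_dist i' (by omega) i'' hi'').trans (by gcongr))
    have h1 : (i' : ℝ) ≤ i := by exact_mod_cast hi'
    have h2 : (i : ℝ) ≤ i'' := by exact_mod_cast hii
    rw [abs_of_nonneg (by linarith), abs_of_nonpos (by linarith)]
    linarith
  by_cases hPL : ∃ i' ≤ i, dist (γ L) (f i') ≤ R
  · obtain ⟨i', hi', hd⟩ := hPL
    rw [hL, dist_comm] at hd
    have := key i' hi' n le_rfl hi (by linarith)
    linarith [gromovProduct_le_dist_right (f 0) (f n) (f i), dist_triangle (f i) (f i') (f n)]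
  -- Discrete connectedness: at the first geodesic vertex not near the initial part of the path, a
  -- nearby path point must come after time `i`, while the preceding vertex is near a point before
  -- it.
  · have hex : ∃ t, ¬ ∃ i' ≤ i, dist (γ t) (f i') ≤ R := ⟨L, hPL⟩
    classical
    have hspec := Nat.find_spec hex
    have hle : Nat.find hex ≤ L := Nat.find_min' hex hPL
    obtain ⟨t, ht⟩ : ∃ t, Nat.find hex = t + 1 := by
      refine Nat.exists_eq_succ_of_ne_zero fun h' => ?_
      rw [h'] at hspec
      exact hspec ⟨0, Nat.zero_le _, by simpa [h0] using hR0⟩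
    have hprev := not_not.1 (Nat.find_min hex (m := t) (by omega))
    rw [ht] at hspec hle
    obtain ⟨i', hi', hd'⟩ := hprev
    obtain ⟨i'', hi'', hd''⟩ := hnear (t + 1) hle
    have hlt : i ≤ i'' := by
      by_contra hcon
      exact hspec ⟨i'', by omega, hd''⟩
    have h1 : dist (γ t) (γ (t + 1)) = 1 := by
      rw [hγ _ (by omega) _ hle]; push_cast; simp
    have := key i' hi' i'' hi'' hlt (by
      have e1 := dist_triangle (f i') (γ t) (f i'')
      have e2 := dist_triangle (γ t) (γ (t + 1)) (f i'')
      rw [dist_comm (f i') (γ t)] at e1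
      linarith)
    have hzero : gromovProduct (f 0) (f n) (γ t) = 0 := by
      have e1 : (t : ℝ) ≤ L := by exact_mod_cast (by omega)
      have e0 : (0 : ℝ) ≤ t := t.cast_nonneg
      unfold gromovProduct
      rw [← h0, ← hL, hγ _ (by omega) _ (by omega), hγ _ (by omega) _ (by omega),
        hγ _ (by omega) _ (by omega)]
      push_cast
      rw [abs_of_nonneg (by linarith), abs_of_nonpos (by linarith), abs_of_nonpos (by linarith)]
      ring
    have e1 := gromovProduct_le_add_dist (f 0) (f n) (f i) (f 0) (f n) (γ t)
    have e2 := dist_triangle (f i) (f i') (γ t)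
    rw [dist_comm (f i') (γ t)] at e2
    simp only [dist_self] at e1
    linarith

/-- A point `v` is close to the geodesics from `a` to `b` if the Gromov product is small. -/
lemma exists_geodesic_point (h : IsFourPointHyperbolic M δ) {a b v : M} {L : ℕ} {γ : ℕ → M}
    (h0 : γ 0 = a) (hL : γ L = b) (hγ : ∀ s ≤ L, ∀ t ≤ L, dist (γ s) (γ t) = |(s : ℝ) - t|) :
    ∃ t ≤ L, dist (γ t) v ≤ gromovProduct a b v + 2 * δ + 1 ∧
      dist (γ t) a ≤ gromovProduct b v a ∧ dist (γ t) b ≤ gromovProduct a v b + 1 := by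
  have hab : dist a b = L := by
    rw [← h0, ← hL, hγ _ (Nat.zero_le _) _ le_rfl]; simp
  have hT0 : 0 ≤ gromovProduct b v a := by
    unfold gromovProduct; linarith [dist_triangle b a v, dist_comm a b]
  have hTL : gromovProduct b v a ≤ L := by
    rw [gromovProduct_comm, ← hab]; exact gromovProduct_le_dist_right _ _ _
  set T := gromovProduct b v a with hT
  have hfl : (⌊T⌋₊ : ℝ) ≤ T := Nat.floor_le hT0
  have hfl' : T ≤ ⌊T⌋₊ + 1 := (Nat.lt_floor_add_one T).le
  have hle : ⌊T⌋₊ ≤ L := by exact_mod_cast hfl.trans hTL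
  have ha : dist (γ ⌊T⌋₊) a = ⌊T⌋₊ := by
    rw [← h0, hγ _ hle _ (Nat.zero_le _)]; simp
  have hb : dist (γ ⌊T⌋₊) b = L - ⌊T⌋₊ := by
    rw [← hL, hγ _ hle _ le_rfl, abs_of_nonpos (by linarith)]; ring
  -- The branch point of the tripod spanned by `a`, `b`, `v`, rounded down to a vertex; rounding
  -- accounts for the `+ 1`.
  refine ⟨⌊T⌋₊, hle, ?_, by linarith, ?_⟩
  · have := h (γ ⌊T⌋₊) a v b
    unfold gromovProduct at *
    rw [hab, ha, hb] at this
    rw [dist_comm v a, dist_comm v b, hab] at *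
    rcases max_cases ((⌊T⌋₊ : ℝ) + dist b v) (L - ⌊T⌋₊ + dist a v) with ⟨h1, _⟩ | ⟨h1, _⟩ <;>
      rw [h1] at this <;> linarith
  · rw [hb]
    unfold gromovProduct at *
    rw [dist_comm b a, hab] at *
    linarith

/-- Quasiisometric embeddings coarsely preserve small Gromov products. -/
theorem exists_gromovProduct_image_le (h : IsFourPointHyperbolic M δ) (hδ : 0 ≤ δ)
    (hgeo : IsDiscretelyGeodesic M) {k : ℝ} (hk : 0 ≤ k) (r : ℝ) :
    ∃ R : ℝ, ∀ (α : Type u) (o φ : α → M), Function.Surjective o →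
      (∀ x y, dist (φ x) (φ y) ≤ k * dist (o x) (o y) + k) →
      (∀ x y, dist (o x) (o y) ≤ k * dist (φ x) (φ y) + k) →
      ∀ a b v, gromovProduct (o a) (o b) (o v) ≤ r → gromovProduct (φ a) (φ b) (φ v) ≤ R := by
  obtain ⟨R, hR⟩ := exists_gromovProduct_quasigeodesic_le h hδ hgeo hk
  refine ⟨R + k + k + (k * (r + 2 * δ + 1) + k), fun α o φ ho hup hlow a b v hr => ?_⟩
  obtain ⟨L, γ, h0, hL, hγ⟩ := hgeo (o a) (o b)
  obtain ⟨t, ht, htv, -, -⟩ := exists_geodesic_point h (v := o v) h0 hL hγ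
  obtain ⟨σ, hσ⟩ := ho.hasRightInverse
  -- The two maps are compared through `α`, since `φ` need not factor through `o`; a geodesic is
  -- lifted by a section of `o`.
  have hq : IsDiscreteQuasigeodesic (fun s => φ (σ (γ s))) L k := by
    constructor
    · intro i hi j hj
      have := hup (σ (γ i)) (σ (γ j))
      rwa [hσ, hσ, hγ i hi j hj] at this
    · intro i hi j hj
      have := hlow (σ (γ i)) (σ (γ j))
      rwa [hσ, hσ, hγ i hi j hj] at this
  have e1 := hR _ L hq t ht
  have e2 := gromovProduct_le_add_dist (φ a) (φ b) (φ v) (φ (σ (γ 0))) (φ (σ (γ L))) (φ (σ (γ t)))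
  have e3 := hup a (σ (γ 0))
  have e4 := hup b (σ (γ L))
  have e5 := hup v (σ (γ t))
  rw [hσ, h0, dist_self] at e3
  rw [hσ, hL, dist_self] at e4
  rw [hσ, dist_comm (o v)] at e5
  rw [h0, hL] at e2
  rw [h0, hL] at e1
  have e6 : k * dist (γ t) (o v) ≤ k * (r + 2 * δ + 1) := by gcongr; linarith
  linarith

/-! ## Centers of triples -/

/-- `v` is close to all sides of the triangle `a`. -/
def IsTriangleCenter (r : ℝ) (a : Fin 3 → M) (v : M) : Prop :=
  ∀ j l, j ≠ l → gromovProduct (a j) (a l) v ≤ r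

/-- The branch point on the side from `a 0` to `a 1` is, up to the error, at tripod distance from
all three vertices, which makes all three Gromov products small. -/
lemma exists_isTriangleCenter (h : IsFourPointHyperbolic M δ) (hδ : 0 ≤ δ)
    (hgeo : IsDiscretelyGeodesic M) (a : Fin 3 → M) : ∃ v, IsTriangleCenter (2 * δ + 1) a v := by
  obtain ⟨L, γ, h0, hL, hγ⟩ := hgeo (a 0) (a 1)
  obtain ⟨t, ht, h1, h2, h3⟩ := exists_geodesic_point h (v := a 2) h0 hL hγ
  have h01 : gromovProduct (a 0) (a 1) (γ t) ≤ 2 * δ + 1 := by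
    unfold gromovProduct at *
    linarith [dist_comm (a 0) (a 1), dist_comm (a 0) (a 2), dist_comm (a 1) (a 2)]
  have h02 : gromovProduct (a 0) (a 2) (γ t) ≤ 2 * δ + 1 := by
    unfold gromovProduct at *
    linarith [dist_comm (a 0) (a 1), dist_comm (a 0) (a 2), dist_comm (a 1) (a 2)]
  have h12 : gromovProduct (a 1) (a 2) (γ t) ≤ 2 * δ + 1 := by
    unfold gromovProduct at *
    linarith [dist_comm (a 0) (a 1), dist_comm (a 0) (a 2), dist_comm (a 1) (a 2)]
  refine ⟨γ t, fun j l hjl => ?_⟩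
  fin_cases j <;> fin_cases l <;> first | exact absurd rfl hjl | assumption | skip
  all_goals rw [gromovProduct_comm]; assumption

/-- Seen from `v`, at most one vertex can have product with `w` above `r + δ`, and symmetrically
from `w`. So some vertex is good for both, and its two products add up to `dist v w`. -/
lemma IsTriangleCenter.dist_le (h : IsFourPointHyperbolic M δ) {r : ℝ} {a : Fin 3 → M} {v w : M}
    (hv : IsTriangleCenter r a v) (hw : IsTriangleCenter r a w) : dist v w ≤ 2 * (r + δ) := by
  have key : ∀ v w : M, IsTriangleCenter r a v → ∀ j l, j ≠ l →
      gromovProduct (a j) w v ≤ r + δ ∨ gromovProduct (a l) w v ≤ r + δ := by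
    intro v w hv j l hjl
    by_contra! hcon
    obtain ⟨h1, h2⟩ := hcon
    rw [gromovProduct_comm (a l)] at h2
    have := h.le_gromovProduct (min_le_left _ _)
      (min_le_right (gromovProduct (a j) w v) (gromovProduct w (a l) v))
    have e := hv j l hjl
    rcases min_cases (gromovProduct (a j) w v) (gromovProduct w (a l) v) with ⟨h3, _⟩ | ⟨h3, _⟩ <;>
      rw [h3] at this <;> linarith
  have hsum : ∀ j, gromovProduct (a j) w v + gromovProduct (a j) v w = dist v w := by
    intro j
    unfold gromovProduct
    rw [dist_comm (a j) w, dist_comm (a j) v, dist_comm w v]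
    ring
  have k1 := key v w hv 0 1 (by decide)
  have k2 := key v w hv 0 2 (by decide)
  have k3 := key v w hv 1 2 (by decide)
  have l1 := key w v hw 0 1 (by decide)
  have l2 := key w v hw 0 2 (by decide)
  have l3 := key w v hw 1 2 (by decide)
  have s0 := hsum 0
  have s1 := hsum 1
  have s2 := hsum 2
  by_contra! hcon
  rcases k1 with k1 | k1 <;> rcases k2 with k2 | k2 <;> rcases k3 with k3 | k3 <;>
    rcases l1 with l1 | l1 <;> rcases l2 with l2 | l2 <;> rcases l3 with l3 | l3 <;> linarith

end GromovProduct

/-! ### Centers of triples of sequences along an ultrafilter -/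

section EventualCenter

open Filter

variable {M : Type*} [PseudoMetricSpace M] {δ : ℝ}

/-- `v` is a center of the triangles `a n` for almost all `n` with respect to a nonprincipal
ultrafilter. -/
def IsEventualCenter (r : ℝ) (a : Fin 3 → ℕ → M) (v : M) : Prop :=
  ∀ᶠ n in (hyperfilter ℕ : Filter ℕ), IsTriangleCenter r (fun j => a j n) v

lemma IsTriangleCenter.mono {r s : ℝ} (hrs : r ≤ s) {a : Fin 3 → M} {v : M}
    (h : IsTriangleCenter r a v) : IsTriangleCenter s a v :=
  fun j l hjl => (h j l hjl).trans hrs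

lemma IsEventualCenter.dist_le (h : IsFourPointHyperbolic M δ) {r s : ℝ} {a : Fin 3 → ℕ → M}
    {v w : M} (hv : IsEventualCenter r a v) (hw : IsEventualCenter s a w) :
    dist v w ≤ 2 * (max r s + δ) := by
  obtain ⟨n, h1, h2⟩ := (hv.and hw).exists
  exact (h1.mono (le_max_left r s)).dist_le h (h2.mono (le_max_right r s))

/-- If some center exists, then there is a center with a uniform constant. -/
lemma IsEventualCenter.exists_uniform (h : IsFourPointHyperbolic M δ) (hδ : 0 ≤ δ)
    (hgeo : IsDiscretelyGeodesic M) (hfin : ∀ (x : M) (r : ℝ), (Metric.closedBall x r).Finite)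
    {r : ℝ} {a : Fin 3 → ℕ → M} {v : M} (hv : IsEventualCenter r a v) :
    ∃ w, IsEventualCenter (2 * δ + 1) a w := by
  choose m hm using fun n => exists_isTriangleCenter h hδ hgeo (fun j => a j n)
  -- The uniform centers `m n` almost always lie in one finite ball around `v`, so the ultrafilter
  -- selects a single vertex.
  have : ∀ᶠ n in (hyperfilter ℕ : Filter ℕ),
      ∃ w ∈ Metric.closedBall v (2 * (max r (2 * δ + 1) + δ)),
        IsTriangleCenter (2 * δ + 1) (fun j => a j n) w := by
    filter_upwards [hv] with n hn
    refine ⟨m n, ?_, hm n⟩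
    rw [Metric.mem_closedBall, dist_comm]
    exact (hn.mono (le_max_left _ _)).dist_le h ((hm n).mono (le_max_right _ _))
  obtain ⟨w, -, hw⟩ := (Ultrafilter.eventually_exists_mem_iff (hfin v _)).1 this
  exact ⟨w, hw⟩

/-- Centers of triples of sequences tending to infinity are stable under bounded perturbations. -/
lemma IsEventualCenter.of_dist_le (h : IsFourPointHyperbolic M δ) (hδ : 0 ≤ δ) {r C : ℝ}
    {a a' : Fin 3 → ℕ → M} {v : M} (hv : IsEventualCenter r a v)
    -- The size `C` of the perturbation does not enter the new constant `r + 2 * δ`: far out, `a j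
    -- n` and `a' j n` have arbitrarily large Gromov product at `v`.
    (haa' : ∀ j n, dist (a j n) (a' j n) ≤ C)
    (ha : ∀ j, Tendsto (fun n => dist v (a j n)) atTop atTop) :
    IsEventualCenter (r + 2 * δ) a' v := by
  have hlarge : ∀ᶠ n in (hyperfilter ℕ : Filter ℕ), ∀ j, r + 2 * δ + 1 + C < dist v (a j n) := by
    rw [eventually_all]
    exact fun j => Nat.hyperfilter_le_atTop ((ha j).eventually_gt_atTop _)
  filter_upwards [hv, hlarge] with n hn hl j l hjl
  by_contra! hcon
  have hd : ∀ j, r + 2 * δ + 1 < gromovProduct (a j n) (a' j n) v := fun j => by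
    linarith [sub_dist_le_gromovProduct (a j n) (a' j n) v, hl j, haa' j n]
  set s := min (gromovProduct (a' j n) (a' l n) v) (r + 2 * δ + 1) with hs
  have hs1 : r + 2 * δ < s := lt_min hcon (lt_add_one _)
  have hs2 : s ≤ gromovProduct (a' j n) (a' l n) v := min_le_left _ _
  have hs3 : s ≤ r + 2 * δ + 1 := min_le_right _ _
  have e1 := h.le_gromovProduct (hs3.trans (hd j).le) hs2
  have e2 := h.le_gromovProduct (z := a l n) e1
    (by rw [gromovProduct_comm]; linarith [hd l])
  linarith [hn j l hjl]

lemma IsEventualCenter.image {α : Type*} {o φ : α → M} {r R : ℝ}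
    (hφ : ∀ a b v, gromovProduct (o a) (o b) (o v) ≤ r → gromovProduct (φ a) (φ b) (φ v) ≤ R)
    {a : Fin 3 → ℕ → α} {v : α} (hv : IsEventualCenter r (fun j n => o (a j n)) (o v)) :
    IsEventualCenter R (fun j n => φ (a j n)) (φ v) := by
  filter_upwards [hv] with n hn j l hjl
  exact hφ _ _ _ (hn j l hjl)

/-- Two geodesic rays with the same origin are close if their Gromov products are unbounded. -/
lemma dist_le_of_unbounded_gromovProduct (h : IsFourPointHyperbolic M δ) (hδ : 0 ≤ δ)
    {γ γ' : ℕ → M} (h0 : γ 0 = γ' 0) (hγ : ∀ s t, dist (γ s) (γ t) = |(s : ℝ) - t|)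
    (hγ' : ∀ s t, dist (γ' s) (γ' t) = |(s : ℝ) - t|)
    (hunb : ∀ r : ℝ, ∃ n, r < gromovProduct (γ n) (γ' n) (γ 0)) (m : ℕ) :
    dist (γ m) (γ' m) ≤ 4 * δ := by
  obtain ⟨n, hn⟩ := hunb m
  have hx : ∀ t, dist (γ 0) (γ t) = t := fun t => by rw [hγ]; simp
  have hx' : ∀ t, dist (γ 0) (γ' t) = t := fun t => by rw [h0, hγ']; simp
  have hmn : (m : ℝ) ≤ n := by
    have := gromovProduct_le_dist_right (γ n) (γ' n) (γ 0)
    rw [hx'] at this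
    linarith
  have e1 : (m : ℝ) ≤ gromovProduct (γ m) (γ n) (γ 0) := by
    unfold gromovProduct
    rw [hx, hx, hγ, abs_of_nonpos (by linarith)]
    linarith
  have e2 : (m : ℝ) ≤ gromovProduct (γ' n) (γ' m) (γ 0) := by
    unfold gromovProduct
    rw [hx', hx', hγ', abs_of_nonneg (by linarith)]
    linarith
  have e3 := h.le_gromovProduct e1 hn.le
  have e4 := h.le_gromovProduct e3 (le_trans (by linarith) e2)
  unfold gromovProduct at e4
  rw [hx, hx'] at e4
  linarith

end EventualCenter

/-! ## The path metric of a connected graph -/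

namespace SimpleGraph

variable {V : Type*} {X : SimpleGraph V}

/-- The path metric of a connected graph. -/
@[reducible] noncomputable def Connected.pseudoMetricSpace (h : X.Connected) :
    PseudoMetricSpace V where
  dist x y := X.dist x y
  dist_self x := by simp
  dist_comm x y := by rw [X.dist_comm]
  dist_triangle x y z := by exact_mod_cast h.dist_triangle

lemma dist_getVert_le {x y : V} (q : X.Walk x y) {s t : ℕ} (hst : s ≤ t)
    (ht : t ≤ q.length) (h : X.Connected) : X.dist (q.getVert s) (q.getVert t) ≤ t - s := by
  induction t, hst using Nat.le_induction with
  | base => simp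
  | succ t hst ih =>
    have h1 := ih (by omega)
    have h2 := (q.adj_getVert_succ (i := t) (by omega))
    have h3 := dist_eq_one_iff_adj.2 h2
    have := h.dist_triangle (u := q.getVert s) (v := q.getVert t) (w := q.getVert (t + 1))
    omega

lemma Connected.dist_getVert (h : X.Connected) {x y : V} (q : X.Walk x y)
    (hq : q.length = X.dist x y) {s t : ℕ} (hst : s ≤ t) (ht : t ≤ q.length) :
    X.dist (q.getVert s) (q.getVert t) = t - s := by
  have h1 := dist_getVert_le q (Nat.zero_le s) (by omega) h
  have h2 := dist_getVert_le q hst ht h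
  have h3 := dist_getVert_le q ht le_rfl h
  rw [Walk.getVert_zero] at h1
  rw [Walk.getVert_length] at h3
  have h4 := h.dist_triangle (u := x) (v := q.getVert s) (w := q.getVert t)
  have h5 := h.dist_triangle (u := x) (v := q.getVert t) (w := y)
  omega

lemma Connected.isDiscretelyGeodesic (h : X.Connected) :
    letI := h.pseudoMetricSpace
    IsDiscretelyGeodesic V := by
  let _ := h.pseudoMetricSpace
  intro x y
  obtain ⟨q, hq⟩ := h.exists_walk_length_eq_dist x y
  refine ⟨q.length, q.getVert, q.getVert_zero, q.getVert_length, fun s hs t ht => ?_⟩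
  change (X.dist _ _ : ℝ) = _
  rcases le_total s t with hst | hst
  · rw [h.dist_getVert q hq hst ht, Nat.cast_sub hst, abs_sub_comm,
      abs_of_nonneg (sub_nonneg.2 (by exact_mod_cast hst))]
  · rw [X.dist_comm, h.dist_getVert q hq hst hs, Nat.cast_sub hst,
      abs_of_nonneg (sub_nonneg.2 (by exact_mod_cast hst))]

lemma Connected.finite_setOf_dist_le (h : X.Connected) (hX : ∀ x, (X.neighborSet x).Finite)
    (x : V) (n : ℕ) : {y | X.dist x y ≤ n}.Finite := by
  induction n with
  | zero =>
    refine (Set.finite_singleton x).subset fun y hy => ?_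
    exact (h.dist_eq_zero_iff.1 (Nat.le_zero.1 hy)).symm
  | succ n ih =>
    refine (ih.union (ih.biUnion fun z _ => hX z)).subset fun y hy => ?_
    obtain ⟨q, hq⟩ := h.exists_walk_length_eq_dist x y
    by_cases hn : X.dist x y ≤ n
    · exact Or.inl hn
    · have hlen : q.length = n + 1 := by have : X.dist x y ≤ n + 1 := hy; omega
      refine Or.inr (Set.mem_biUnion (x := q.getVert n) ?_ ?_)
      · have := h.dist_getVert q hq (Nat.zero_le n) (by omega)
        rw [Walk.getVert_zero] at this
        exact (this.trans (Nat.sub_zero n)).le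
      · have := q.adj_getVert_succ (i := n) (by omega)
        rwa [← hlen, Walk.getVert_length] at this

lemma dist_smul_smul {Γ : Type*} [Group Γ] [MulAction Γ V] (h : X.Connected)
    (hadj : ∀ (g : Γ) (x y : V), X.Adj (g • x) (g • y) ↔ X.Adj x y) (g : Γ) (x y : V) :
    X.dist (g • x) (g • y) = X.dist x y := by
  have key : ∀ (g : Γ) (x y : V), X.dist (g • x) (g • y) ≤ X.dist x y := by
    intro g x y
    obtain ⟨q, hq⟩ := h.exists_walk_length_eq_dist x y
    let f : X →g X := ⟨fun x => g • x, fun hxy => (hadj g _ _).2 hxy⟩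
    rw [← hq, ← Walk.length_map f q]
    exact SimpleGraph.dist_le (q.map f)
  refine le_antisymm (key g x y) ?_
  simpa using key g⁻¹ (g • x) (g • y)

lemma GeodesicRay.dist_eq {x₀ : V} (γ : X.GeodesicRay x₀) (s t : ℕ) :
    (X.dist (γ.toFun s) (γ.toFun t) : ℝ) = |(s : ℝ) - t| := by
  rw [SimpleGraph.dist, γ.geodesic, ENat.toNat_natCast, Nat.dist]
  rcases le_total s t with hst | hst
  · rw [Nat.sub_eq_zero_of_le hst, zero_add, Nat.cast_sub hst, abs_sub_comm,
      abs_of_nonneg (sub_nonneg.2 (by exact_mod_cast hst))]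
  · rw [Nat.sub_eq_zero_of_le hst, add_zero, Nat.cast_sub hst,
      abs_of_nonneg (sub_nonneg.2 (by exact_mod_cast hst))]

/-- Geodesic rays that define different boundary points have bounded Gromov products. -/
lemma exists_gromovProduct_le_of_not_equiv (h : X.Connected) {δ : ℝ} (hδ : 0 ≤ δ)
    (hhyp : letI := h.pseudoMetricSpace; IsFourPointHyperbolic V δ) {x₀ : V}
    {γ γ' : X.GeodesicRay x₀} (hne : ¬ X.raySetoid x₀ γ γ') :
    letI := h.pseudoMetricSpace
    ∃ r : ℝ, ∀ n, gromovProduct (γ.toFun n) (γ'.toFun n) x₀ ≤ r := by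
  let _ := h.pseudoMetricSpace
  by_contra! hcon
  have hclose := dist_le_of_unbounded_gromovProduct hhyp hδ (γ := γ.toFun) (γ' := γ'.toFun)
    (γ.start.trans γ'.start.symm) γ.dist_eq γ'.dist_eq (by rwa [γ.start])
  have hclose' : ∀ m, X.edist (γ.toFun m) (γ'.toFun m) ≤ (⌈4 * δ⌉₊ : ℕ∞) := by
    intro m
    rw [← (h _ _).coe_dist_eq_edist]
    have : (X.dist (γ.toFun m) (γ'.toFun m) : ℝ) ≤ ⌈4 * δ⌉₊ := (hclose m).trans (Nat.le_ceil _)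
    exact_mod_cast this
  refine hne ⟨⟨⌈4 * δ⌉₊, ?_⟩, ⟨⌈4 * δ⌉₊, ?_⟩⟩
  · rintro _ ⟨m, rfl⟩
    exact ⟨_, ⟨m, rfl⟩, hclose' m⟩
  · rintro _ ⟨m, rfl⟩
    exact ⟨_, ⟨m, rfl⟩, by rw [SimpleGraph.edist_comm]; exact hclose' m⟩

/-- Three boundary points give a triple of geodesic rays for which the origin is a center. -/
lemma exists_isEventualCenter_geodesicRay (h : X.Connected) {δ : ℝ} (hδ : 0 ≤ δ)
    (hhyp : letI := h.pseudoMetricSpace; IsFourPointHyperbolic V δ) {x₀ : V}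
    (hcard : 3 ≤ ENat.card (X.GromovBoundary x₀)) :
    letI := h.pseudoMetricSpace
    ∃ (r : ℝ) (γ : Fin 3 → X.GeodesicRay x₀), IsEventualCenter r (fun j => (γ j).toFun) x₀ := by
  let _ := h.pseudoMetricSpace
  rw [← Set.encard_univ] at hcard
  obtain ⟨T, -, hT⟩ := Set.exists_subset_encard_eq hcard
  obtain ⟨x, y, z, hxy, hxz, hyz, -⟩ := Set.encard_eq_three.1 hT
  let ξ : Fin 3 → X.GromovBoundary x₀ := ![x, y, z]
  have hξ : ∀ j l, j ≠ l → ξ j ≠ ξ l := by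
    intro j l hjl
    fin_cases j <;> fin_cases l <;> simp_all [ξ, eq_comm]
  let γ : Fin 3 → X.GeodesicRay x₀ := fun j => (ξ j).out
  have hγ : ∀ j l, j ≠ l → ¬ X.raySetoid x₀ (γ j) (γ l) := by
    intro j l hjl hcon
    refine hξ j l hjl ?_
    rw [← Quotient.out_eq (ξ j), ← Quotient.out_eq (ξ l)]
    exact Quotient.sound hcon
  have hb : ∀ j l, ∃ r : ℝ, j ≠ l → ∀ n,
      gromovProduct ((γ j).toFun n) ((γ l).toFun n) x₀ ≤ r := by
    intro j l
    by_cases hjl : j = l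
    · exact ⟨0, fun h' => absurd hjl h'⟩
    · obtain ⟨r, hr⟩ := exists_gromovProduct_le_of_not_equiv h hδ hhyp (hγ j l hjl)
      exact ⟨r, fun _ => hr⟩
  choose r hr using hb
  refine ⟨∑ j, ∑ l, |r j l|, γ, Filter.Eventually.of_forall fun n j l hjl => ?_⟩
  calc _ ≤ r j l := hr j l hjl n
    _ ≤ |r j l| := le_abs_self _
    _ ≤ ∑ l, |r j l| := Finset.single_le_sum (f := fun l => |r j l|)
      (fun _ _ => abs_nonneg _) (Finset.mem_univ l)
    _ ≤ _ := Finset.single_le_sum (f := fun j => ∑ l, |r j l|)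
      (fun _ _ => Finset.sum_nonneg fun _ _ => abs_nonneg _) (Finset.mem_univ j)

end SimpleGraph

/-! ## Conjugation by elements of the extension -/

/-- The action by conjugation of a group on (a copy of) a normal subgroup. -/
noncomputable def MonoidHom.conjRange {H : Type u} {G : Type v} [Group H] [Group G] (i : H →* G)
    (hi : Function.Injective i) [i.range.Normal] : G →* MulAut H :=
  (MulAut.congr (MonoidHom.ofInjective hi).symm).toMonoidHom.comp MulAut.conjNormal

lemma MonoidHom.apply_conjRange {H : Type u} {G : Type v} [Group H] [Group G] (i : H →* G)
    (hi : Function.Injective i) [i.range.Normal] (g : G) (h : H) :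
    i (i.conjRange hi g h) = g * i h * g⁻¹ := by
  rw [← MonoidHom.ofInjective_apply hi, ← MonoidHom.ofInjective_apply (x := h) hi]
  simp [MonoidHom.conjRange, MulAut.congr, MulAut.conjNormal_apply]

lemma MonoidHom.conjRange_apply_self {H : Type u} {G : Type v} [Group H] [Group G] (i : H →* G)
    (hi : Function.Injective i) [i.range.Normal] (h h' : H) :
    i.conjRange hi (i h) h' = h * h' * h⁻¹ :=
  hi (by simp [MonoidHom.apply_conjRange])

/-! ### Conjugation as a uniform quasiisometry of orbits -/

section Orbit

variable {H : Type u} [Group H] {V : Type w} [PseudoMetricSpace V] [MulAction H V] {x₀ : V}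

lemma dist_smul_smul_eq [IsIsometricSMul H V] (g h : H) (x : V) : dist (g • x) (h • x) = dist x ((g⁻¹ * h) • x) := by
  rw [← dist_smul g x, mul_smul, smul_inv_smul]

lemma dist_mul_smul_le [IsIsometricSMul H V] (g h : H) (x : V) :
    dist x ((g * h) • x) ≤ dist x (g • x) + dist x (h • x) := by
  have := dist_triangle x (g • x) ((g * h) • x)
  rwa [dist_smul_smul_eq g, inv_mul_cancel_left] at this

variable [TopologicalSpace H] [IsTopologicalGroup H]

/-- The set is a union of cosets of the stabilizer, one for each vertex of a finite ball. -/
lemma isCompact_setOf_dist_smul_le [MulAction.IsPretransitive H V]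
    (hfin : ∀ (x : V) (r : ℝ), (Metric.closedBall x r).Finite)
    (hcomp : IsCompact (MulAction.stabilizer H x₀ : Set H)) (r : ℝ) :
    IsCompact {h : H | dist x₀ (h • x₀) ≤ r} := by
  choose σ hσ using MulAction.exists_smul_eq H x₀
  have : {h : H | dist x₀ (h • x₀) ≤ r} = ⋃ y ∈ Metric.closedBall x₀ r,
      (fun h => σ y * h) '' (MulAction.stabilizer H x₀ : Set H) := by
    ext h
    simp only [Set.mem_ofPred_eq, Set.mem_iUnion, Set.mem_image, SetLike.mem_coe,
      MulAction.mem_stabilizer_iff, Metric.mem_closedBall, exists_prop]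
    constructor
    · intro hh
      refine ⟨h • x₀, by rwa [dist_comm], (σ (h • x₀))⁻¹ * h, ?_, by group⟩
      rw [mul_smul, inv_smul_eq_iff, hσ]
    · rintro ⟨y, hy, h', hh', rfl⟩
      rwa [mul_smul, hh', hσ, dist_comm]
  rw [this]
  exact (hfin x₀ r).isCompact_biUnion fun y _ => hcomp.image (continuous_const_mul _)

/-- Displacement of `x₀` is locally constant because the stabilizer is open. -/
lemma exists_dist_smul_le_of_isCompact (hopen : IsOpen (MulAction.stabilizer H x₀ : Set H))
    {C : Set H} (hC : IsCompact C) : ∃ r : ℝ, ∀ h ∈ C, dist x₀ (h • x₀) ≤ r := by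
  have hcont : Continuous fun h : H => dist x₀ (h • x₀) := by
    refine IsLocallyConstant.continuous ((IsLocallyConstant.iff_exists_open _).2 fun h => ?_)
    refine ⟨(fun h' => h⁻¹ * h') ⁻¹' (MulAction.stabilizer H x₀ : Set H),
      hopen.preimage (continuous_const_mul _), by simp, fun h' hh' => ?_⟩
    have : (h⁻¹ * h') • x₀ = x₀ := hh'
    rw [mul_smul, inv_smul_eq_iff] at this
    rw [this]
  obtain ⟨r, hr⟩ := hC.exists_bound_of_continuousOn hcont.continuousOn
  exact ⟨r, fun h hh => (le_abs_self _).trans (hr h hh)⟩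

variable [IsIsometricSMul H V] [MulAction.IsPretransitive H V]
  {G : Type v} [Group G] [TopologicalSpace G] [IsTopologicalGroup G] {i : H →* G}
  {hi : Function.Injective i} [i.range.Normal]

/-- Conjugation is coarsely Lipschitz, uniformly on compact sets. -/
lemma exists_dist_conjRange_smul_le (hgeo : IsDiscretelyGeodesic V)
    (hfin : ∀ (x : V) (r : ℝ), (Metric.closedBall x r).Finite)
    (hopen : IsOpen (MulAction.stabilizer H x₀ : Set H))
    (hcomp : IsCompact (MulAction.stabilizer H x₀ : Set H))
    (hi_cont : Continuous i) (hi_open : IsOpenMap i) {B : Set G} (hB : IsCompact B) :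
    ∃ k : ℝ, 0 ≤ k ∧ ∀ g ∈ B, ∀ h : H,
      dist x₀ (i.conjRange hi g h • x₀) ≤ k * dist x₀ (h • x₀) + k := by
  have hF := isCompact_setOf_dist_smul_le hfin hcomp 1
  have hC : IsCompact ((fun q : G × H => q.1 * i q.2 * q.1⁻¹) ''
      (B ×ˢ {h : H | dist x₀ (h • x₀) ≤ 1})) :=
    (hB.prod hF).image (by fun_prop)
  -- Conjugates by `B` of the elements moving `x₀` by at most 1 form a compact subset of the range
  -- of `i`, so they come from a compact subset of `H`.
  have hC' := (Topology.IsOpenEmbedding.of_continuous_injective_isOpenMap hi_cont hi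
    hi_open).isInducing.isCompact_preimage' hC (by
      rintro _ ⟨⟨g, h⟩, -, rfl⟩
      exact ⟨_, i.apply_conjRange hi g h⟩)
  obtain ⟨k, hk⟩ := exists_dist_smul_le_of_isCompact hopen hC'
  have hk' : ∀ g ∈ B, ∀ h : H, dist x₀ (h • x₀) ≤ 1 →
      dist x₀ (i.conjRange hi g h • x₀) ≤ |k| := fun g hg h hh =>
    (hk _ ⟨(g, h), ⟨hg, hh⟩, (i.apply_conjRange hi g h).symm⟩).trans (le_abs_self k)
  refine ⟨|k|, abs_nonneg k, fun g hg h => ?_⟩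
  obtain ⟨L, γ, h0, hL, hγ⟩ := hgeo x₀ (h • x₀)
  -- Each edge costs at most `|k|`. The start costs `|k|` too, as conjugation need not preserve the
  -- stabilizer of `x₀`.
  have key : ∀ t ≤ L, ∀ h : H, h • x₀ = γ t →
      dist x₀ (i.conjRange hi g h • x₀) ≤ |k| * t + |k| := by
    intro t
    induction t with
    | zero =>
      intro _ h hh
      have := hk' g hg h (by rw [hh, h0, dist_self]; exact zero_le_one)
      simpa using this
    | succ t ih =>
      intro ht h hh
      obtain ⟨h', hh'⟩ := MulAction.exists_smul_eq H x₀ (γ t)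
      have e1 := ih (by omega) h' hh'
      have e2 := hk' g hg (h'⁻¹ * h) (by
        rw [← dist_smul_smul_eq, hh, hh', hγ t (by omega) _ ht]
        push_cast
        simp)
      have e3 := dist_mul_smul_le (i.conjRange hi g h') (i.conjRange hi g (h'⁻¹ * h)) x₀
      rw [← map_mul, mul_inv_cancel_left] at e3
      push_cast
      linarith
  have hdL : dist x₀ (h • x₀) = L := by
    have := hγ _ (Nat.zero_le _) _ le_rfl
    rw [h0, hL] at this
    simpa using this
  rw [hdL]
  exact key L le_rfl h hL.symm

/-- Conjugation is a quasiisometry, uniformly on compact sets. -/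
lemma exists_quasiisometry_conjRange (hgeo : IsDiscretelyGeodesic V)
    (hfin : ∀ (x : V) (r : ℝ), (Metric.closedBall x r).Finite)
    (hopen : IsOpen (MulAction.stabilizer H x₀ : Set H))
    (hcomp : IsCompact (MulAction.stabilizer H x₀ : Set H))
    (hi_cont : Continuous i) (hi_open : IsOpenMap i) {B : Set G} (hB : IsCompact B) :
    ∃ k : ℝ, 0 < k ∧ ∀ g ∈ B,
      (∀ x y : H, dist (i.conjRange hi g x • x₀) (i.conjRange hi g y • x₀) ≤
        k * dist (x • x₀) (y • x₀) + k) ∧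
      (∀ x y : H, dist (x • x₀) (y • x₀) ≤
        k * dist (i.conjRange hi g x • x₀) (i.conjRange hi g y • x₀) + k) := by
  -- Inverses are included because the lower bound for `g` is the upper bound for `g⁻¹`.
  obtain ⟨k, hk0, hk⟩ := exists_dist_conjRange_smul_le (hi := hi) hgeo hfin hopen hcomp hi_cont
    hi_open (hB.union hB.inv)
  have hlip : ∀ g ∈ B ∪ B⁻¹, ∀ x y : H,
      dist (i.conjRange hi g x • x₀) (i.conjRange hi g y • x₀) ≤
        (k + 1) * dist (x • x₀) (y • x₀) + (k + 1) := by
    intro g hg x y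
    have := hk g hg (x⁻¹ * y)
    rw [map_mul, map_inv, ← dist_smul_smul_eq, ← dist_smul_smul_eq] at this
    linarith [dist_nonneg (x := x • x₀) (y := y • x₀)]
  refine ⟨k + 1, by linarith, fun g hg => ⟨hlip g (Or.inl hg), fun x y => ?_⟩⟩
  have := hlip g⁻¹ (Or.inr (by simpa using hg)) (i.conjRange hi g x) (i.conjRange hi g y)
  simpa [map_inv] using this

end Orbit

/-! ### The coarse section obtained from centers -/

open Filter in
/-- A coarse section of an extension with non-elementary hyperbolic kernel: it meets every coset of
the kernel, and quotients of its elements that are close modulo the kernel are close. -/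
theorem exists_coarse_section {H : Type u} [Group H] [TopologicalSpace H] [IsTopologicalGroup H]
    (hH : IsNonElementaryHyperbolic H) {G : Type v} [Group G] [TopologicalSpace G]
    [IsTopologicalGroup G] {i : H →* G} (hi : Function.Injective i) [i.range.Normal]
    (hi_cont : Continuous i) (hi_open : IsOpenMap i) :
    ∃ S : Set G, (∀ g, ∃ h, g * i h ∈ S) ∧ ∀ B : Set G, IsCompact B → ∃ C : Set G, IsCompact C ∧
      ∀ g ∈ S, ∀ g' ∈ S, ∀ h, ∀ b ∈ B, g' = g * i h * b → g⁻¹ * g' ∈ C := by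
  obtain ⟨-, V, hact, X, hX, ⟨δ, hδ, hhyp⟩, x₀, hcard⟩ := hH
  let _ := hX.connected.pseudoMetricSpace
  have hgeo : IsDiscretelyGeodesic V := hX.connected.isDiscretelyGeodesic
  have htrans := hX.transitive
  have hisom : IsIsometricSMul H V := ⟨fun g => Isometry.of_dist_eq fun x y =>
    congrArg Nat.cast (SimpleGraph.dist_smul_smul hX.connected hX.adj_smul g x y)⟩
  have hfin : ∀ (x : V) (r : ℝ), (Metric.closedBall x r).Finite := by
    intro x r
    refine (hX.connected.finite_setOf_dist_le hX.locallyFinite x ⌈r⌉₊).subset fun y hy => ?_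
    rw [Metric.mem_closedBall, dist_comm] at hy
    have : (X.dist x y : ℝ) ≤ ⌈r⌉₊ := le_trans hy (Nat.le_ceil r)
    exact_mod_cast this
  replace hhyp : IsFourPointHyperbolic V δ := hhyp
  have hopen := hX.isOpen_stabilizer x₀
  have hcomp := hX.isCompact_stabilizer x₀
  have hQI := fun (B : Set G) (hB : IsCompact B) => exists_quasiisometry_conjRange (hi := hi) hgeo
    hfin hopen hcomp hi_cont hi_open hB
  obtain ⟨r, γ, hγ⟩ := SimpleGraph.exists_isEventualCenter_geodesicRay hX.connected hδ hhyp hcard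
  choose a ha using fun j n => MulAction.exists_smul_eq H x₀ ((γ j).toFun n)
  set c := i.conjRange hi with hc
  -- Conjugation acts on `H` rather than on `V`, so the rays are lifted to `H` before being
  -- conjugated.
  let seq : G → Fin 3 → ℕ → V := fun g j n => c g (a j n) • x₀
  have himage : ∀ (B : Set G), IsCompact B → ∀ r, ∃ R, ∀ g ∈ B, ∀ (g' : G) (h : H),
      IsEventualCenter r (seq g') (h • x₀) →
        IsEventualCenter R (seq (g * g')) (c g h • x₀) := by
    intro B hB r
    obtain ⟨k, hk0, hk⟩ := hQI B hB
    obtain ⟨R, hR⟩ := exists_gromovProduct_image_le.{u} hhyp hδ hgeo hk0.le r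
    refine ⟨R, fun g hg g' h hh => ?_⟩
    have := IsEventualCenter.image (o := fun h : H => h • x₀) (φ := fun h => c g h • x₀)
      (hR H _ _ (MulAction.surjective_smul H x₀) (hk g hg).1 (hk g hg).2) hh
    simpa [seq, map_mul] using this
  have htend : ∀ (g : G) (v : V) (j : Fin 3),
      Tendsto (fun n => dist v (seq g j n)) atTop atTop := by
    intro g v j
    obtain ⟨k, hk0, hk⟩ := hQI {g} isCompact_singleton
    have hlow : ∀ n : ℕ, k⁻¹ * (n : ℝ) + (- 1 - dist v x₀) ≤ dist v (seq g j n) := by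
      intro n
      have e1 := (hk g rfl).2 1 (a j n)
      have e2 : dist x₀ ((γ j).toFun n) = n := by
        have := (γ j).dist_eq 0 n
        rw [(γ j).start] at this
        exact this.trans (by simp)
      rw [ha, one_smul, e2, map_one, one_smul] at e1
      have e3 : k⁻¹ * (n : ℝ) ≤ dist x₀ (seq g j n) + 1 := by
        rw [inv_mul_le_iff₀ hk0]
        linarith
      linarith [dist_triangle x₀ v (seq g j n), dist_comm v x₀]
    refine tendsto_atTop_mono hlow (tendsto_atTop_add_const_right _ _ ?_)
    exact tendsto_natCast_atTop_atTop.const_mul_atTop (inv_pos.2 hk0)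
  -- Conjugating the original center gives a constant depending on `g`; `exists_uniform` removes
  -- this dependence.
  have hcenter : ∀ g, ∃ v, IsEventualCenter (2 * δ + 1) (seq g) v := by
    intro g
    obtain ⟨R, hR⟩ := himage {g} isCompact_singleton r
    have h1 : IsEventualCenter r (seq 1) ((1 : H) • x₀) := by
      simpa [seq, ha] using hγ
    simpa using (hR g rfl 1 1 h1).exists_uniform hhyp hδ hgeo hfin
  -- Conjugation by `h` is left translation by `h` followed by right multiplication by `h⁻¹`, which
  -- moves orbit points by the fixed distance `dist x₀ (h⁻¹ • x₀)`. The loss `2 * δ` does not depend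
  -- on `h`.
  have hmove : ∀ (g : G) (h : H) (r : ℝ) (v : V), IsEventualCenter r (seq g) v →
      IsEventualCenter (r + 2 * δ) (seq (i h * g)) (h • v) := by
    intro g h r v hv
    have h1 : IsEventualCenter r (fun j n => h • seq g j n) (h • v) := by
      filter_upwards [hv] with n hn j l hjl
      simpa only [gromovProduct, dist_smul] using hn j l hjl
    refine h1.of_dist_le hhyp hδ (C := dist x₀ (h⁻¹ • x₀)) (fun j n => ?_) fun j => ?_
    · change dist (h • c g (a j n) • x₀) (c (i h * g) (a j n) • x₀) ≤ _
      rw [map_mul, MulAut.mul_apply, hc, MonoidHom.conjRange_apply_self, mul_smul, mul_smul,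
        dist_smul, dist_smul]
    · simpa only [dist_smul] using htend g v j
  -- The inverse turns right multiplication of `g` by `H` into left multiplication, so `hmove`
  -- applies. The constant is that of `hcenter` plus one use of `hmove`.
  refine ⟨{g | IsEventualCenter (2 * δ + 1 + 2 * δ) (seq g⁻¹) x₀}, fun g => ?_, fun B hB => ?_⟩
  · obtain ⟨v, hv⟩ := hcenter g⁻¹
    obtain ⟨h, rfl⟩ := MulAction.exists_smul_eq H x₀ v
    refine ⟨h, ?_⟩
    have := hmove _ h⁻¹ _ _ hv
    rw [inv_smul_smul] at this
    simpa using this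
  · obtain ⟨R, hR⟩ := himage B⁻¹ hB.inv (2 * δ + 1 + 2 * δ + 2 * δ)
    obtain ⟨k, hk0, hk⟩ := hQI B⁻¹ hB.inv
    set N := k * (2 * (max R (2 * δ + 1 + 2 * δ) + δ)) + k with hN
    have hF := isCompact_setOf_dist_smul_le (x₀ := x₀) hfin hcomp N
    refine ⟨(i '' {h | dist x₀ (h • x₀) ≤ N}) * B, (hF.image hi_cont).mul hB, ?_⟩
    rintro g hg g' hg' h b hb rfl
    refine ⟨i h, ⟨h, ?_, rfl⟩, b, hb, by group⟩
    -- The center is followed along `(g h b)⁻¹ = b⁻¹ h⁻¹ g⁻¹`: from `x₀` to `h⁻¹ • x₀`, then to `c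
    -- b⁻¹ h⁻¹ • x₀`. The latter must be close to `x₀`, and the lower quasiisometry bound for `b⁻¹`
    -- controls `h`.
    have e1 := hmove _ h⁻¹ _ _ hg
    have e2 := hR b⁻¹ (by simpa using hb) _ _ e1
    have e3 : b⁻¹ * (i h⁻¹ * g⁻¹) = (g * i h * b)⁻¹ := by rw [map_inv]; group
    rw [e3] at e2
    have e4 := e2.dist_le hhyp hg'
    have e5 := (hk b⁻¹ (by simpa using hb)).2 h⁻¹ 1
    rw [map_one, one_smul] at e5
    have e6 : dist (h⁻¹ • x₀) x₀ = dist x₀ (h • x₀) := by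
      rw [← dist_smul h, smul_inv_smul]
    refine e6.symm.trans_le ?_
    exact e5.trans (by rw [hN]; gcongr)

/-! ### Word metrics on coset spaces -/

section WordDist

variable {G : Type u} [Group G] [TopologicalSpace G] {K : Set G} {U : Subgroup G} {A : Set G}

lemma IsCayleyAbelsData.wordDist_congr (h : IsCayleyAbelsData K U A) {g g' s s' : G}
    (hg : (g : G ⧸ U) = s) (hg' : (g' : G ⧸ U) = s') : wordDist U A g g' = wordDist U A s s' := by
  rw [← (dist_cayleyAbelsGraph h g g').2, ← (dist_cayleyAbelsGraph h s s').2, hg, hg']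

lemma IsCayleyAbelsData.wordDist_triangle (h : IsCayleyAbelsData K U A) (g g' g'' : G) :
    wordDist U A g g'' ≤ wordDist U A g g' + wordDist U A g' g'' := by
  simp only [← (dist_cayleyAbelsGraph h _ _).2]
  exact (dist_cayleyAbelsGraph h g g').1.dist_triangle_left _

lemma IsCayleyAbelsData.exists_word (h : IsCayleyAbelsData K U A) (g g' : G) :
    ∃ l : List G, l.length = wordDist U A g g' ∧ (∀ a ∈ l, a ∈ A) ∧
      ((g⁻¹ * g' : G) : G ⧸ U) = (l.prod : G ⧸ U) := by
  refine Nat.sInf_mem (s := {n : ℕ | ∃ l : List G, l.length = n ∧ (∀ a ∈ l, a ∈ A) ∧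
    ((g⁻¹ * g' : G) : G ⧸ U) = (l.prod : G ⧸ U)}) (Set.nonempty_iff_ne_empty.2 fun hempty => ?_)
  -- An empty set has infimum 0 by convention; then the two cosets coincide and the empty word
  -- contradicts emptiness.
  have hzero : wordDist U A g g' = 0 := by rw [wordDist, hempty, Nat.sInf_empty]
  obtain ⟨hr, hd⟩ := dist_cayleyAbelsGraph h g g'
  rw [hzero, hr.dist_eq_zero_iff, QuotientGroup.eq] at hd
  refine Set.eq_empty_iff_forall_notMem.1 hempty 0 ⟨[], rfl, by simp, ?_⟩
  rw [List.prod_nil, eq_comm, QuotientGroup.eq]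
  simpa using hd

/-- The distance from the base coset is constant on cosets of the open subgroup `U`, hence bounded
on compact sets; left invariance does the rest. -/
lemma IsCayleyAbelsData.exists_wordDist_le [IsTopologicalGroup G] (h : IsCayleyAbelsData K U A)
    {C : Set G} (hC : IsCompact C) :
    ∃ N : ℕ, ∀ g g' : G, g⁻¹ * g' ∈ C → wordDist U A g g' ≤ N := by
  have hcont : Continuous fun g : G => (wordDist U A 1 g : ℝ) := by
    refine IsLocallyConstant.continuous ((IsLocallyConstant.iff_exists_open _).2 fun g => ?_)
    refine ⟨(fun g' => g⁻¹ * g') ⁻¹' (U : Set G), h.isOpen.preimage (continuous_const_mul _),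
      by simp, fun g' hg' => ?_⟩
    rw [h.wordDist_congr rfl (QuotientGroup.eq.2 hg').symm]
  obtain ⟨r, hr⟩ := hC.exists_bound_of_continuousOn hcont.continuousOn
  refine ⟨⌈r⌉₊, fun g g' hg => ?_⟩
  have h1 : wordDist U A g g' = wordDist U A 1 (g⁻¹ * g') := by simp [wordDist]
  have h2 : (wordDist U A 1 (g⁻¹ * g') : ℝ) ≤ ⌈r⌉₊ :=
    (le_abs_self _).trans ((hr _ hg).trans (Nat.le_ceil r))
  rw [h1]
  exact_mod_cast h2

lemma IsCayleyAbelsData.wordDist_map_le (h : IsCayleyAbelsData K U A) {Q : Type v} [Group Q]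
    (p : G →* Q) (g g' : G) :
    wordDist (U.map p) (p '' A) (p g) (p g') ≤ wordDist U A g g' := by
  obtain ⟨l, hlen, hl, hprod⟩ := h.exists_word g g'
  refine Nat.sInf_le ⟨l.map p, by rw [List.length_map, hlen], ?_, ?_⟩
  · intro a ha
    obtain ⟨b, hb, rfl⟩ := List.mem_map.1 ha
    exact ⟨b, hl b hb, rfl⟩
  · rw [QuotientGroup.eq] at hprod ⊢
    rw [← map_list_prod, ← map_inv, ← map_mul, ← map_inv, ← map_mul]
    exact Subgroup.mem_map_of_mem p hprod

end WordDist

/-! ### Lifting words from the quotient -/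

theorem proposition6p2
    {H : Type u} {G : Type v} {Q : Type w} [Group H] [Group G] [Group Q]
    [TopologicalSpace H] [IsTopologicalGroup H] [T2Space H] [SecondCountableTopology H]
    [LocallyCompactSpace H] [TotallyDisconnectedSpace H]
    [TopologicalSpace G] [IsTopologicalGroup G] [T2Space G] [SecondCountableTopology G]
    [LocallyCompactSpace G] [TotallyDisconnectedSpace G]
    [TopologicalSpace Q] [IsTopologicalGroup Q] [T2Space Q] [SecondCountableTopology Q]
    [LocallyCompactSpace Q] [TotallyDisconnectedSpace Q]
    (hH : IsNonElementaryHyperbolic H)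
    (hG : IsCompactlyGeneratedGroup G) (hQ : IsCompactlyGeneratedGroup Q)
    (i : H →* G) (p : G →* Q)
    (hi_cont : Continuous i) (hi_open : IsOpenMap i) (hi_inj : Function.Injective i)
    (hp_cont : Continuous p) (hp_open : IsOpenMap p) (hp_surj : Function.Surjective p)
    (hexact : i.range = p.ker)
    (K : Set G) (U : Subgroup G) (A : Set G) (hKUA : IsCayleyAbelsData K U A) :
    ∃ S : Set (G ⧸ U), IsQuasiisometricSection p U A S ∧
      ∃ k ε₀ : ℝ, 1 ≤ k ∧ 0 ≤ ε₀ ∧ ∀ g g' : G, (g : G ⧸ U) ∈ S → (g' : G ⧸ U) ∈ S →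
        (wordDist (U.map p) (p '' A) (p g) (p g') : ℝ) ≤ (wordDist U A g g' : ℝ) ∧
        (wordDist U A g g' : ℝ) ≤
          k * (wordDist (U.map p) (p '' A) (p g) (p g') : ℝ) + ε₀ := by
  have hnormal : i.range.Normal := hexact ▸ inferInstance
  have hpi : ∀ h, p (i h) = 1 := fun h => by
    have : i h ∈ p.ker := hexact ▸ ⟨h, rfl⟩
    exact this
  have hmap := hKUA.map p hp_cont hp_open hp_surj
  obtain ⟨T, hT, hTB⟩ := exists_coarse_section hH hi_inj hi_cont hi_open
  -- As `1 ∈ A`, this compact set contains both the letters and `U`, the two kinds of steps in a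
  -- lift.
  obtain ⟨C, hC, hTC⟩ := hTB ((U : Set G) * A * U)
    ((hKUA.isCompact.mul hKUA.finite.isCompact).mul hKUA.isCompact)
  obtain ⟨N, hN⟩ := hKUA.exists_wordDist_le hC
  have hstep : ∀ g ∈ T, ∀ g' ∈ T, ∀ b ∈ (U : Set G) * A * U, p g' = p g * p b →
      wordDist U A g g' ≤ N := by
    intro g hg g' hg' b hb hgb
    have hker : g⁻¹ * g' * b⁻¹ ∈ p.ker := by
      rw [MonoidHom.mem_ker, map_mul, map_mul, hgb, map_inv, map_inv]
      group
    rw [← hexact] at hker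
    obtain ⟨h, hh⟩ := hker
    exact hN _ _ (hTC g hg g' hg' h b hb (by rw [hh]; group))
  -- After each letter the lift is corrected by an element of the kernel to return to `T`. The final
  -- `N` pays for `u`, since the word in `Q` reaches its target only modulo `p(U)`.
  have hword : ∀ l : List Q, (∀ a ∈ l, a ∈ p '' A) → ∀ g ∈ T, ∀ g' ∈ T, ∀ u ∈ U,
      p g' = p g * l.prod * p u → wordDist U A g g' ≤ N * l.length + N := by
    intro l
    induction l with
    | nil =>
      intro _ g hg g' hg' u hu he
      have := hstep g hg g' hg' u ⟨1, ⟨1, U.one_mem, 1, hKUA.one_mem, by simp⟩, u, hu, by simp⟩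
        (by simpa using he)
      simpa using this
    | cons a l ih =>
      intro hl g hg g' hg' u hu he
      obtain ⟨b, hb, rfl⟩ := hl a (by simp)
      obtain ⟨h, hgh⟩ := hT (g * b)
      have hp1 : p (g * b * i h) = p g * p b := by rw [map_mul, hpi, mul_one, map_mul]
      have e1 := hstep g hg _ hgh b ⟨b, ⟨1, U.one_mem, b, hb, by simp⟩, 1, U.one_mem, by simp⟩ hp1
      have e2 := ih (fun c hc => hl c (by simp [hc])) _ hgh g' hg' u hu (by
        rw [hp1, he, List.prod_cons]
        group)
      have e3 := hKUA.wordDist_triangle g (g * b * i h) g'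
      rw [List.length_cons]
      linarith
  have hupper : ∀ g g' : G, (g : G ⧸ U) ∈ ((↑) '' T : Set (G ⧸ U)) →
      (g' : G ⧸ U) ∈ ((↑) '' T : Set (G ⧸ U)) →
      wordDist U A g g' ≤ N * wordDist (U.map p) (p '' A) (p g) (p g') + N := by
    rintro g g' ⟨s, hs, hsg⟩ ⟨s', hs', hsg'⟩
    have hcoset : ∀ {x y : G}, (x : G ⧸ U) = y → (p x : Q ⧸ U.map p) = p y := by
      intro x y hxy
      rw [QuotientGroup.eq] at hxy ⊢
      rw [← map_inv, ← map_mul]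
      exact Subgroup.mem_map_of_mem p hxy
    -- A representative of a coset in the section need not lie in `T`, so it is replaced by one that
    -- does.
    rw [← hKUA.wordDist_congr hsg hsg', ← hmap.wordDist_congr (hcoset hsg) (hcoset hsg')]
    obtain ⟨l, hlen, hl, hprod⟩ := hmap.exists_word (p s) (p s')
    rw [eq_comm, QuotientGroup.eq] at hprod
    obtain ⟨u, hu, hpu⟩ := hprod
    rw [← hlen]
    exact hword l hl s hs s' hs' u hu (by rw [hpu]; group)
  have hbound : ∀ g g' : G, (g : G ⧸ U) ∈ ((↑) '' T : Set (G ⧸ U)) →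
      (g' : G ⧸ U) ∈ ((↑) '' T : Set (G ⧸ U)) →
      (wordDist (U.map p) (p '' A) (p g) (p g') : ℝ) ≤ (wordDist U A g g' : ℝ) ∧
        (wordDist U A g g' : ℝ) ≤
          (N + 1) * (wordDist (U.map p) (p '' A) (p g) (p g') : ℝ) + N := by
    intro g g' hg hg'
    refine ⟨by exact_mod_cast hKUA.wordDist_map_le p g g', ?_⟩
    have : (wordDist U A g g' : ℝ) ≤ N * wordDist (U.map p) (p '' A) (p g) (p g') + N := by
      exact_mod_cast hupper g g' hg hg'
    linarith [(Nat.cast_nonneg _ : (0 : ℝ) ≤ wordDist (U.map p) (p '' A) (p g) (p g'))]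
  have hk : (1 : ℝ) ≤ N + 1 := by linarith [(Nat.cast_nonneg N : (0 : ℝ) ≤ N)]
  refine ⟨(↑) '' T, ⟨Set.eq_univ_of_forall fun x => ?_, N + 1, N, hk, Nat.cast_nonneg N,
    fun g g' hg hg' => ⟨?_, (hbound g g' hg hg').2⟩⟩, N + 1, N, hk, Nat.cast_nonneg N, hbound⟩
  · induction x using QuotientGroup.induction_on with | H q => ?_
    obtain ⟨g, rfl⟩ := hp_surj q
    obtain ⟨h, hh⟩ := hT g
    exact ⟨g * i h, ⟨_, hh, rfl⟩, by rw [map_mul, hpi, mul_one]⟩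
  · refine le_trans ?_ (hbound g g' hg hg').1
    have hd : (0 : ℝ) ≤ wordDist (U.map p) (p '' A) (p g) (p g') := Nat.cast_nonneg _
    have h1 : 1 / ((N : ℝ) + 1) ≤ 1 := by rw [div_le_one (by linarith)]; exact hk
    nlinarith [(Nat.cast_nonneg N : (0 : ℝ) ≤ N)]
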